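/- **Setting.** Let $f:\mathbb R^n\to\mathbb R$ be twice continuously differentiable and coercive ($f(x)\to\infty$ as $\|x\|\to\infty$), with $\|\nabla f(x)-\nabla f(y)\|\le L\|x-y\|$ and $\|\nabla^2 f(x)-\nabla^2 f(y)\|_2\le M\|x-y\|$ for all $x,y$, where $L>0$. Assume that $f$ is a (uniformly) Morse function: for some $\beta>0$, every eigenvalue $\lambda$ of $\nabla^2 f(x^*)$ at every critical point $x^*$ satisfies $|\lambda|>\beta$. A *strict saddle* is a critical point at which the Hessian has a negative eigenvalue (local maxima included). **Algorithm (CCRGD).** Put $\alpha=1/L$, $\kappa=\beta/L$; let $\varepsilon>0$ be a radius and $P$ a real number (the minimum unstable projection value). Start at $x_0$ with flag $\Xi=0$. For $k=0,1,2,\dots$: * If $\|\nabla f(x_k)\|>L\varepsilon$, set $x_{k+1}=x_k-\alpha\nabla f(x_k)$ and $\Xi\leftarrow 0$. * If $\|\nabla f(x_k)\|\le L\varepsilon$ and $\Xi=1$, set $x_{k+1}=x_k-\alpha\nabla f(x_k)$ and leave $\Xi=1$. * If $\|\nabla f(x_k)\|\le L\varepsilon$ and $\Xi=0$, put $y_0=x_k$,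 $y_1=y_0-\alpha\nabla f(y_0)$, $V_1=\langle y_1-y_0,y_1-y_0\rangle$, $V_2=\alpha\langle y_1-y_0,\nabla f(y_1)-\nabla f(y_0)\rangle$, $\mathbf H=\alpha\nabla^2 f(x_k)$. If either $$\tfrac{4\varepsilon^2}{27\kappa^2}<V_1-V_2<\tfrac{50P+4}{27}\,\tfrac{\varepsilon^2}{\kappa^2},\qquad\text{or}\qquad 0<V_1-V_2\le\tfrac{4\varepsilon^2}{27\kappa^2}\ \text{ and }\ \lambda_{\min}(\mathbf H)<0,$$ let $x_{k+1}$ be any minimizer of $\tfrac12(x-x_k)^T\mathbf H(x-x_k)$ over the sphere $\|x-x_k\|=\|\nabla f(x_k)\|/\beta$; otherwise let $x_{k+1}=y_1$. In both cases set $\Xi\leftarrow 1$. The algorithm is run indefinitely, without a stopping rule. **Theorem.** Let $x_0\in\mathbb R^n$ be a point that is not a strict saddle. There is $\varepsilon_0>0$ (depending on $f,L,M,\beta,x_0$) such that for every $\varepsilon\in(0,\varepsilon_0)$ and every real $P$ the following holds. Let $(x_k)$ be any iterate sequence generated by CCRGD from $x_0$ such that no gradient update from a noncritical iterate lands exactly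 on a strict saddle, i.e. for every $k$ with $\nabla f(x_k)\neq0$ the point $x_k-\alpha\nabla f(x_k)$ is not a strict saddle (this is automatic if $\nabla f$ is $L'$-Lipschitz for some $L'<L$). Then there is a local minimum $x^*$ of $f$ such that a subsequence of $(x_k)$ converges to $x^*$, $x^*$ is a fixed point of the algorithm (from $x^*$, with either value of the flag, every iteration returns $x^*$), and the whole sequence $(x_k)$ converges to $x^*$. -/

import Mathlib

open Filter Topology

noncomputable section

namespace CCRGD

variable {n : ℕ}

/-- The Hessian of `f` at `x`, as the linear operator `v ↦ ∇²f(x) v` on Euclidean space: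
the derivative of the gradient field. -/
def hessian (f : EuclideanSpace ℝ (Fin n) → ℝ) (x : EuclideanSpace ℝ (Fin n)) :
    EuclideanSpace ℝ (Fin n) →L[ℝ] EuclideanSpace ℝ (Fin n) :=
  fderiv ℝ (gradient f) x

/-- `lam` is an eigenvalue of the operator `A`. -/
def IsEigenvalue (A : EuclideanSpace ℝ (Fin n) →L[ℝ] EuclideanSpace ℝ (Fin n)) (lam : ℝ) : Prop :=
  Module.End.HasEigenvalue (A : Module.End ℝ (EuclideanSpace ℝ (Fin n))) lam

/-- A strict saddle point: a critical point at which the Hessian has a negative eigenvalue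
(local maxima are included). -/
def IsStrictSaddle (f : EuclideanSpace ℝ (Fin n) → ℝ) (x : EuclideanSpace ℝ (Fin n)) : Prop :=
  gradient f x = 0 ∧ ∃ lam : ℝ, lam < 0 ∧ IsEigenvalue (hessian f x) lam

/-- One gradient descent update with step size `α = 1 / L`. -/
def gradStep (f : EuclideanSpace ℝ (Fin n) → ℝ) (L : ℝ) (x : EuclideanSpace ℝ (Fin n)) :
    EuclideanSpace ℝ (Fin n) :=
  x - (1 / L) • gradient f x

/-- `V₁ = ⟨y₁ - y₀, y₁ - y₀⟩` with `y₀ = x` and `y₁` the gradient descent update of `y₀`. -/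
def V₁ (f : EuclideanSpace ℝ (Fin n) → ℝ) (L : ℝ) (x : EuclideanSpace ℝ (Fin n)) : ℝ :=
  inner ℝ (gradStep f L x - x) (gradStep f L x - x)

/-- `V₂ = α ⟨y₁ - y₀, ∇f(y₁) - ∇f(y₀)⟩`, with the same `y₀`, `y₁` and `α = 1 / L`. -/
def V₂ (f : EuclideanSpace ℝ (Fin n) → ℝ) (L : ℝ) (x : EuclideanSpace ℝ (Fin n)) : ℝ :=
  (1 / L) * inner ℝ (gradStep f L x - x) (gradient f (gradStep f L x) - gradient f x)

/-- The scaled Hessian `H = α ∇²f(x)`, `α = 1 / L`. -/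
def scaledHessian (f : EuclideanSpace ℝ (Fin n) → ℝ) (L : ℝ) (x : EuclideanSpace ℝ (Fin n)) :
    EuclideanSpace ℝ (Fin n) →L[ℝ] EuclideanSpace ℝ (Fin n) :=
  (1 / L) • hessian f x

/-- The outcomes of the constrained eigenvalue problem at `x`: all minimizers of
`z ↦ ½ (z - x)ᵀ H (z - x)` over the sphere `‖z - x‖ = ‖∇f(x)‖ / β`. -/
def curvatureSteps (f : EuclideanSpace ℝ (Fin n) → ℝ) (L β : ℝ)
    (x : EuclideanSpace ℝ (Fin n)) : Set (EuclideanSpace ℝ (Fin n)) :=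
  {z | z ∈ Metric.sphere x (‖gradient f x‖ / β) ∧
    IsMinOn (fun w => (1 / 2 : ℝ) * inner ℝ (w - x) (scaledHessian f L x (w - x)))
      (Metric.sphere x (‖gradient f x‖ / β)) z}

/-- The curvature check, with `κ = β / L` and threshold `P` (the value `P_min(ε)`):
either `4ε²/(27κ²) < V₁ - V₂ < ((50 P + 4)/27) ε²/κ²`,
or `0 < V₁ - V₂ ≤ 4ε²/(27κ²)` and the least eigenvalue of `H` is negative. -/
def CurvatureCheck (f : EuclideanSpace ℝ (Fin n) → ℝ) (L β ε P : ℝ)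
    (x : EuclideanSpace ℝ (Fin n)) : Prop :=
  (4 * ε ^ 2 / (27 * (β / L) ^ 2) < V₁ f L x - V₂ f L x ∧
      V₁ f L x - V₂ f L x < (50 * P + 4) / 27 * (ε ^ 2 / (β / L) ^ 2)) ∨
  (0 < V₁ f L x - V₂ f L x ∧
      V₁ f L x - V₂ f L x ≤ 4 * ε ^ 2 / (27 * (β / L) ^ 2) ∧
      ∃ lam : ℝ, lam < 0 ∧ IsEigenvalue (scaledHessian f L x) lam)

/-- One iteration of CCRGD: `Step f L β ε P x Ξ x' Ξ'` says that from the iterate `x` with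
condition flag `Ξ` the algorithm may move to the iterate `x'` with condition flag `Ξ'`.
The algorithm is run without a stopping rule: when the curvature check does not ask for a
second-order step, the already computed gradient descent update `y₁` is the next iterate. -/
inductive Step (f : EuclideanSpace ℝ (Fin n) → ℝ) (L β ε P : ℝ) :
    EuclideanSpace ℝ (Fin n) → Bool → EuclideanSpace ℝ (Fin n) → Bool → Prop
  | largeGradient (x : EuclideanSpace ℝ (Fin n)) (Ξ : Bool)
      (hx : L * ε < ‖gradient f x‖) : Step f L β ε P x Ξ (gradStep f L x) false
  | flagged (x : EuclideanSpace ℝ (Fin n))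
      (hx : ‖gradient f x‖ ≤ L * ε) : Step f L β ε P x true (gradStep f L x) true
  | secondOrder (x z : EuclideanSpace ℝ (Fin n))
      (hx : ‖gradient f x‖ ≤ L * ε) (hc : CurvatureCheck f L β ε P x)
      (hz : z ∈ curvatureSteps f L β x) : Step f L β ε P x false z true
  | firstOrder (x : EuclideanSpace ℝ (Fin n))
      (hx : ‖gradient f x‖ ≤ L * ε) (hc : ¬ CurvatureCheck f L β ε P x) :
      Step f L β ε P x false (gradStep f L x) true

/-- `x` is an iterate sequence generated by CCRGD from `x₀`, the flag being initially `0`.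
(The constrained eigenvalue problem may have several solutions, so there may be several
such sequences.) -/
def IsIterateSequence (f : EuclideanSpace ℝ (Fin n) → ℝ) (L β ε P : ℝ)
    (x₀ : EuclideanSpace ℝ (Fin n)) (x : ℕ → EuclideanSpace ℝ (Fin n)) : Prop :=
  x 0 = x₀ ∧ ∃ Ξ : ℕ → Bool, Ξ 0 = false ∧
    ∀ k, Step f L β ε P (x k) (Ξ k) (x (k + 1)) (Ξ (k + 1))

/-- `x` is a fixed point of CCRGD: every iteration started at `x`, with either value of the
flag, stays at `x`. -/
def IsFixedPointOfAlgorithm (f : EuclideanSpace ℝ (Fin n) → ℝ) (L β ε P : ℝ)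
    (x : EuclideanSpace ℝ (Fin n)) : Prop :=
  ∀ (Ξ Ξ' : Bool) (z : EuclideanSpace ℝ (Fin n)), Step f L β ε P x Ξ z Ξ' → z = x

end CCRGD

end

/-! ### Gradient steps: Taylor bounds, descent, and the sign of `V₁ - V₂`. -/

namespace CCRGD

variable {n : ℕ} {f : EuclideanSpace ℝ (Fin n) → ℝ} {L : ℝ}

/-! Near a critical point p whose Hessian eigenvalues have modulus at least b > β, the gradient
itself serves as local coordinate: a gradient step acts on ∇f as I - ∇²f(p)/L, up to a relative
error 2Mr/L on the ball of radius r (`IsRegular.norm_gradient_gradStep_sub_le`). Split ∇f along the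
positive (P) and negative (Q) eigenspaces. The P-part contracts by about 1 - b/L and the Q-part
expands by about 1 + b/L, so the cone ‖Q∇f‖ ≥ c‖P∇f‖ is forward invariant and the Q-part grows
geometrically in it (`cone_step`). A run confined to the ball and free of curvature steps therefore
stays in the stable cone ‖Q∇f‖ ≤ c‖P∇f‖.

At a strict saddle, two facts contradict such confinement. In the stable cone, with small gradient
and flag off, the curvature check succeeds (`IsRegular.curvatureCheck_of_stable`). A curvature step
has length ‖∇f‖/β almost along the Q-directions, so it changes the Q-part by nearly (b/β)‖∇f‖ or
more; as b > β it overshoots into the unstable cone (`IsRegular.jump_Q`). Infinitely many curvature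
steps in the ball are also impossible (`exists_forall_not_jump`), so some last time with flag off
yields the contradiction (`exists_last_entry`, `IsRegular.exists_not_mem_ball`).

Globally, curvature steps happen only near strict saddles (`IsRegular.not_curvatureCheck`). They may
increase f, but they land so close to the saddle that leaving its ball costs a definite amount of f,
independent of ε (`IsRegular.exists_exit`). Since f is bounded below, only gradient steps remain
after some time. Then ∇f tends to 0, nondegeneracy traps the run near one critical point, and the
escape result shows that this point is not a strict saddle, hence is a local minimum.

The value of P is irrelevant: curvature steps are analysed whatever triggers them, and wherever the
check has to be decided, `V₁ - V₂` is at most the lower threshold. -/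

lemma gradient_eq_comp (f : EuclideanSpace ℝ (Fin n) → ℝ) :
    gradient f = (InnerProductSpace.toDual ℝ (EuclideanSpace ℝ (Fin n))).symm ∘ fderiv ℝ f := rfl

lemma contDiff_gradient (hf : ContDiff ℝ 2 f) : ContDiff ℝ 1 (gradient f) := by
  rw [gradient_eq_comp]
  exact (InnerProductSpace.toDual ℝ (EuclideanSpace ℝ (Fin n))).symm.contDiff.comp
    (hf.fderiv_right (by norm_num))

lemma hasFDerivAt_gradient (hf : ContDiff ℝ 2 f) (x : EuclideanSpace ℝ (Fin n)) :
    HasFDerivAt (gradient f) (hessian f x) x :=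
  ((contDiff_gradient hf).differentiable (by norm_num) x).hasFDerivAt

lemma inner_hessian (hf : ContDiff ℝ 2 f) (x v w : EuclideanSpace ℝ (Fin n)) :
    inner ℝ (hessian f x v) w = fderiv ℝ (fderiv ℝ f) x v w := by
  have hd : DifferentiableAt ℝ (fderiv ℝ f) x :=
    ((hf.fderiv_right (m := 1) (by norm_num)).differentiable (by norm_num)) x
  have h1 := ((hasFDerivAt_gradient hf x).inner ℝ (hasFDerivAt_const w x))
  have h2 : HasFDerivAt (fun y => fderiv ℝ f y w)
      ((ContinuousLinearMap.apply ℝ ℝ w).comp (fderiv ℝ (fderiv ℝ f) x)) x :=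
    (ContinuousLinearMap.apply ℝ ℝ w).hasFDerivAt.comp x hd.hasFDerivAt
  have h3 : (fun y => inner ℝ (gradient f y) w) = fun y => fderiv ℝ f y w :=
    funext fun y => inner_gradient_left
  rw [h3] at h1
  simpa using DFunLike.congr_fun (h1.unique h2) v

lemma hessian_isSymmetric (hf : ContDiff ℝ 2 f) (x : EuclideanSpace ℝ (Fin n)) :
    (hessian f x : EuclideanSpace ℝ (Fin n) →ₗ[ℝ] EuclideanSpace ℝ (Fin n)).IsSymmetric := by
  intro v w
  have hs : IsSymmSndFDerivAt ℝ f x :=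
    (hf.contDiffAt (x := x)).isSymmSndFDerivAt (by simp)
  rw [ContinuousLinearMap.coe_coe, inner_hessian hf, real_inner_comm, inner_hessian hf]
  exact hs v w

lemma norm_hessian_le (hL : 0 < L)
    (hgrad : ∀ x y, ‖gradient f x - gradient f y‖ ≤ L * ‖x - y‖)
    (x : EuclideanSpace ℝ (Fin n)) : ‖hessian f x‖ ≤ L :=
  norm_fderiv_le_of_lip' ℝ hL.le (Eventually.of_forall fun y => hgrad y x)

/-- The two-sided form is needed: the upper bound gives descent of gradient steps, and at a critical
point both signs bound f near a saddle. It follows by comparing derivatives along t ↦ x + tv with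
those of (L/2)‖v‖²t². -/
lemma abs_sub_sub_inner_gradient_le (hf : ContDiff ℝ 2 f)
    (hgrad : ∀ x y, ‖gradient f x - gradient f y‖ ≤ L * ‖x - y‖)
    (x v : EuclideanSpace ℝ (Fin n)) :
    |f (x + v) - f x - inner ℝ (gradient f x) v| ≤ L / 2 * ‖v‖ ^ 2 := by
  have hd : ∀ t : ℝ, HasDerivAt (fun t : ℝ => f (x + t • v) - f x - t * inner ℝ (gradient f x) v)
      (inner ℝ (gradient f (x + t • v)) v - inner ℝ (gradient f x) v) t := by
    intro t
    have h1 : HasDerivAt (fun t : ℝ => x + t • v) v t := by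
      simpa using ((hasDerivAt_id t).smul_const v).const_add x
    have h2 : HasFDerivAt f (fderiv ℝ f (x + t • v)) (x + t • v) :=
      (hf.differentiable (by norm_num) _).hasFDerivAt
    have h3 := h2.comp_hasDerivAt t h1
    rw [← inner_gradient_left] at h3
    refine ((h3.sub_const (f x)).sub
      ((hasDerivAt_id t).mul_const (inner ℝ (gradient f x) v))).congr_deriv ?_
    rw [one_mul]
  have hB : ∀ t : ℝ, HasDerivAt (fun t : ℝ => L / 2 * ‖v‖ ^ 2 * t ^ 2) (L * t * ‖v‖ ^ 2) t := by
    intro t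
    refine ((hasDerivAt_pow 2 t).const_mul (L / 2 * ‖v‖ ^ 2)).congr_deriv ?_
    norm_num
    ring
  have h := image_norm_le_of_norm_deriv_right_le_deriv_boundary (a := 0) (b := 1)
    (f := fun t : ℝ => f (x + t • v) - f x - t * inner ℝ (gradient f x) v)
    (fun t _ => (hd t).continuousAt.continuousWithinAt) (fun t _ => (hd t).hasDerivWithinAt)
    (B := fun t : ℝ => L / 2 * ‖v‖ ^ 2 * t ^ 2) (by simp) hB (fun t ht => by
      rw [← inner_sub_left]
      refine (norm_inner_le_norm _ _).trans ?_
      have h4 := hgrad (x + t • v) x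
      rw [add_sub_cancel_left, norm_smul, Real.norm_of_nonneg ht.1] at h4
      nlinarith [norm_nonneg v]) (x := 1) (by simp)
  simpa using h

lemma apply_gradStep_le (hL : 0 < L) (hf : ContDiff ℝ 2 f)
    (hgrad : ∀ x y, ‖gradient f x - gradient f y‖ ≤ L * ‖x - y‖)
    (x : EuclideanSpace ℝ (Fin n)) :
    f (gradStep f L x) ≤ f x - 1 / (2 * L) * ‖gradient f x‖ ^ 2 := by
  have h := (abs_le.1 (abs_sub_sub_inner_gradient_le hf hgrad x (-((1 / L) • gradient f x)))).2
  rw [inner_neg_right, inner_smul_right, real_inner_self_eq_norm_sq, norm_neg, norm_smul,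
    Real.norm_of_nonneg (by positivity), ← sub_eq_add_neg] at h
  have e : L / 2 * (1 / L * ‖gradient f x‖) ^ 2 = 1 / (2 * L) * ‖gradient f x‖ ^ 2 := by
    field_simp
  have e2 : 1 / L * ‖gradient f x‖ ^ 2 = 2 * (1 / (2 * L) * ‖gradient f x‖ ^ 2) := by
    field_simp
  rw [e] at h
  unfold gradStep
  linarith

lemma abs_sub_le_of_gradient_eq_zero (hf : ContDiff ℝ 2 f)
    (hgrad : ∀ x y, ‖gradient f x - gradient f y‖ ≤ L * ‖x - y‖)
    {p : EuclideanSpace ℝ (Fin n)} (hp : gradient f p = 0) (x : EuclideanSpace ℝ (Fin n)) :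
    |f x - f p| ≤ L / 2 * ‖x - p‖ ^ 2 := by
  simpa [hp] using abs_sub_sub_inner_gradient_le hf hgrad p (x - p)

/-- Mean value inequality for ∇f - ∇²f(p) on the ball of radius R, where the Hessian deviates from
its value at p by at most MR. -/
lemma norm_gradient_sub_sub_hessian_le (hf : ContDiff ℝ 2 f) {M : ℝ} (hM : 0 ≤ M)
    (hhess : ∀ x y, ‖hessian f x - hessian f y‖ ≤ M * ‖x - y‖)
    {p x y : EuclideanSpace ℝ (Fin n)} {R : ℝ} (hx : ‖x - p‖ ≤ R) (hy : ‖y - p‖ ≤ R) :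
    ‖gradient f y - gradient f x - hessian f p (y - x)‖ ≤ M * R * ‖y - x‖ := by
  refine (convex_closedBall p R).norm_image_sub_le_of_norm_hasFDerivWithin_le'
    (fun z _ => (hasFDerivAt_gradient hf z).hasFDerivWithinAt) (fun z hz => ?_)
    (mem_closedBall_iff_norm.2 hx) (mem_closedBall_iff_norm.2 hy)
  exact (hhess z p).trans (mul_le_mul_of_nonneg_left (mem_closedBall_iff_norm.1 hz) hM)

lemma gradStep_sub (x : EuclideanSpace ℝ (Fin n)) :
    gradStep f L x - x = -((1 / L) • gradient f x) := by
  simp [gradStep]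

lemma norm_gradStep_sub (hL : 0 < L) (x : EuclideanSpace ℝ (Fin n)) :
    ‖gradStep f L x - x‖ = ‖gradient f x‖ / L := by
  rw [gradStep_sub, norm_neg, norm_smul, Real.norm_of_nonneg (by positivity)]
  ring

lemma V₁_sub_V₂ (x : EuclideanSpace ℝ (Fin n)) :
    V₁ f L x - V₂ f L x =
      (1 / L) ^ 2 * inner ℝ (gradient f x) (gradient f (gradStep f L x)) := by
  simp only [V₁, V₂, gradStep_sub, inner_neg_left, inner_neg_right, inner_smul_left,
    inner_smul_right, inner_sub_right]
  simp
  ring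

/-- The step has length ‖∇f(x)‖/L, so the gradient changes by at most ‖∇f(x)‖; expanding the square
of that change gives the bound. Through `V₁_sub_V₂` it yields the sign of `V₁ - V₂`. -/
lemma norm_sq_gradient_gradStep_le (hL : 0 < L)
    (hgrad : ∀ x y, ‖gradient f x - gradient f y‖ ≤ L * ‖x - y‖)
    (x : EuclideanSpace ℝ (Fin n)) :
    ‖gradient f (gradStep f L x)‖ ^ 2 ≤
      2 * inner ℝ (gradient f x) (gradient f (gradStep f L x)) := by
  have h := hgrad (gradStep f L x) x
  rw [norm_gradStep_sub hL, mul_div_cancel₀ _ hL.ne'] at h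
  have h2 := norm_sub_sq_real (gradient f (gradStep f L x)) (gradient f x)
  rw [real_inner_comm] at h2
  have h3 : ‖gradient f (gradStep f L x) - gradient f x‖ ^ 2 ≤ ‖gradient f x‖ ^ 2 := by gcongr
  linarith

lemma V₁_sub_V₂_pos (hL : 0 < L)
    (hgrad : ∀ x y, ‖gradient f x - gradient f y‖ ≤ L * ‖x - y‖)
    {x : EuclideanSpace ℝ (Fin n)} (hx : gradient f (gradStep f L x) ≠ 0) :
    0 < V₁ f L x - V₂ f L x := by
  rw [V₁_sub_V₂]
  have h := norm_sq_gradient_gradStep_le hL hgrad x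
  have h2 : 0 < ‖gradient f (gradStep f L x)‖ ^ 2 := by positivity
  have : 0 < inner ℝ (gradient f x) (gradient f (gradStep f L x)) := by linarith
  positivity

lemma CurvatureCheck.V₁_sub_V₂_pos {β ε P : ℝ} {x : EuclideanSpace ℝ (Fin n)}
    (h : CurvatureCheck f L β ε P x) : 0 < V₁ f L x - V₂ f L x := by
  rcases h with h | h
  · exact lt_of_le_of_lt (by positivity) h.1
  · exact h.1

lemma CurvatureCheck.gradient_ne_zero {β ε P : ℝ} {x : EuclideanSpace ℝ (Fin n)}
    (h : CurvatureCheck f L β ε P x) : gradient f x ≠ 0 := by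
  intro h0
  have := h.V₁_sub_V₂_pos
  rw [V₁_sub_V₂, h0] at this
  simp at this

lemma gradStep_of_gradient_eq_zero {x : EuclideanSpace ℝ (Fin n)} (hx : gradient f x = 0) :
    gradStep f L x = x := by
  simp [gradStep, hx]

/-- A zero gradient makes `V₁ - V₂` vanish, and both branches of the curvature check require it to
be positive, so only a trivial gradient step is possible. -/
lemma isFixedPointOfAlgorithm_of_gradient_eq_zero (β ε P : ℝ)
    {x : EuclideanSpace ℝ (Fin n)} (hx : gradient f x = 0) :
    IsFixedPointOfAlgorithm f L β ε P x := by
  intro Ξ Ξ' z h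
  cases h with
  | largeGradient _ h => exact gradStep_of_gradient_eq_zero hx
  | flagged h => exact gradStep_of_gradient_eq_zero hx
  | secondOrder _ h hc hz => exact absurd hx hc.gradient_ne_zero
  | firstOrder h hc => exact gradStep_of_gradient_eq_zero hx

end CCRGD

/-! ### Spectral splitting of a symmetric operator with a gap at zero. -/

namespace CCRGD

variable {n : ℕ}

/-- The partial expansion of a vector in an orthonormal basis, over the indices in `s`. -/
noncomputable def basisProj (e : OrthonormalBasis (Fin n) ℝ (EuclideanSpace ℝ (Fin n)))
    (s : Finset (Fin n)) : EuclideanSpace ℝ (Fin n) →L[ℝ] EuclideanSpace ℝ (Fin n) :=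
  ∑ i ∈ s, (innerSL ℝ (e i)).smulRight (e i)

lemma inner_basisProj (e : OrthonormalBasis (Fin n) ℝ (EuclideanSpace ℝ (Fin n)))
    (s : Finset (Fin n)) (j : Fin n) (v : EuclideanSpace ℝ (Fin n)) :
    inner ℝ (e j) (basisProj e s v) = if j ∈ s then inner ℝ (e j) v else 0 := by
  simp [basisProj, inner_sum, inner_smul_right, e.inner_eq_ite]

lemma sum_inner_sq_eq_norm_sq (e : OrthonormalBasis (Fin n) ℝ (EuclideanSpace ℝ (Fin n)))
    (v : EuclideanSpace ℝ (Fin n)) : ∑ i, inner ℝ (e i) v ^ 2 = ‖v‖ ^ 2 := by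
  simpa using e.sum_sq_norm_inner_right v

lemma norm_sq_basisProj (e : OrthonormalBasis (Fin n) ℝ (EuclideanSpace ℝ (Fin n)))
    (s : Finset (Fin n)) (v : EuclideanSpace ℝ (Fin n)) :
    ‖basisProj e s v‖ ^ 2 = ∑ i ∈ s, inner ℝ (e i) v ^ 2 := by
  rw [← sum_inner_sq_eq_norm_sq e]
  simp [inner_basisProj, ite_pow, Finset.sum_ite_mem]

/-- `P` and `Q` are complementary projections onto the positive and the negative part of the
spectrum of the symmetric operator `A`, whose eigenvalues have absolute value in `[b, L]`. -/
structure IsSplitting (A : EuclideanSpace ℝ (Fin n) →L[ℝ] EuclideanSpace ℝ (Fin n)) (L b : ℝ)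
    (P Q : EuclideanSpace ℝ (Fin n) →L[ℝ] EuclideanSpace ℝ (Fin n)) : Prop where
  norm_sq : ∀ v, ‖v‖ ^ 2 = ‖P v‖ ^ 2 + ‖Q v‖ ^ 2
  contract : ∀ v, ‖P (v - (1 / L) • A v)‖ ≤ (1 - b / L) * ‖P v‖
  expand : ∀ v, (1 + b / L) * ‖Q v‖ ≤ ‖Q (v - (1 / L) • A v)‖
  inner_le : ∀ v, inner ℝ v (v - (1 / L) • A v) ≤ (1 - b / L) * ‖P v‖ ^ 2 + 2 * ‖Q v‖ ^ 2
  norm_P_le : ∀ v, ‖P (A v)‖ ≤ L * ‖P v‖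
  le_norm_Q : ∀ v, b * ‖Q v‖ ≤ ‖Q (A v)‖
  le_norm : ∀ v, b * ‖v‖ ≤ ‖A v‖
  le_inner : ∀ v m, (∀ lam, IsEigenvalue A lam → m ≤ lam) →
    b * ‖P v‖ ^ 2 + m * ‖Q v‖ ^ 2 ≤ inner ℝ v (A v)
  le_inner_of_nonneg : (∀ lam, IsEigenvalue A lam → 0 ≤ lam) → ∀ v, b * ‖v‖ ^ 2 ≤ inner ℝ v (A v)

lemma IsEigenvalue.exists_eq_smul
    {A : EuclideanSpace ℝ (Fin n) →L[ℝ] EuclideanSpace ℝ (Fin n)} {lam : ℝ}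
    (h : IsEigenvalue A lam) : ∃ v, ‖v‖ = 1 ∧ A v = lam • v := by
  obtain ⟨v, hv⟩ := h.exists_hasEigenvector
  refine ⟨(‖v‖⁻¹ : ℝ) • v, ?_, ?_⟩
  · rw [norm_smul, norm_inv, norm_norm, inv_mul_cancel₀ (norm_ne_zero_iff.2 hv.2)]
  · have : A v = lam • v := hv.apply_eq_smul
    rw [map_smul, this, smul_comm]

lemma IsEigenvalue.abs_le {A : EuclideanSpace ℝ (Fin n) →L[ℝ] EuclideanSpace ℝ (Fin n)}
    {lam L : ℝ} (h : IsEigenvalue A lam) (hA : ‖A‖ ≤ L) : |lam| ≤ L := by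
  obtain ⟨v, hv, hv2⟩ := h.exists_eq_smul
  have := A.le_of_opNorm_le hA v
  rwa [hv2, norm_smul, hv, mul_one, mul_one] at this

lemma exists_orthonormalBasis_inner_apply
    {A : EuclideanSpace ℝ (Fin n) →L[ℝ] EuclideanSpace ℝ (Fin n)}
    (hA : (A : EuclideanSpace ℝ (Fin n) →ₗ[ℝ] EuclideanSpace ℝ (Fin n)).IsSymmetric) :
    ∃ (e : OrthonormalBasis (Fin n) ℝ (EuclideanSpace ℝ (Fin n))) (lam : Fin n → ℝ),
      (∀ i, IsEigenvalue A (lam i)) ∧ ∀ i v, inner ℝ (e i) (A v) = lam i * inner ℝ (e i) v := by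
  have hn : Module.finrank ℝ (EuclideanSpace ℝ (Fin n)) = n := finrank_euclideanSpace_fin
  refine ⟨hA.eigenvectorBasis hn, hA.eigenvalues hn, hA.hasEigenvalue_eigenvalues hn, ?_⟩
  intro i v
  have h := hA.eigenvectorBasis_apply_self_apply hn v i
  simpa [OrthonormalBasis.repr_apply_apply] using h

/-- In an orthonormal eigenbasis all the estimates can be checked coordinate by coordinate. The gap
excludes the eigenvalue 0, so the complement of the positive indices carries only eigenvalues at
most -b. -/
lemma exists_isSplitting {A : EuclideanSpace ℝ (Fin n) →L[ℝ] EuclideanSpace ℝ (Fin n)} {L b : ℝ}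
    (hA : (A : EuclideanSpace ℝ (Fin n) →ₗ[ℝ] EuclideanSpace ℝ (Fin n)).IsSymmetric)
    (hAL : ‖A‖ ≤ L) (hb : 0 < b) (hbL : b ≤ L) (hgap : ∀ lam, IsEigenvalue A lam → b ≤ |lam|) :
    ∃ P Q, IsSplitting A L b P Q := by
  classical
  have hL : 0 < L := hb.trans_le hbL
  obtain ⟨e, lam, hlam, hcoord⟩ := exists_orthonormalBasis_inner_apply hA
  set s : Finset (Fin n) := {i | 0 < lam i} with hs
  have hP : ∀ i ∈ s, b ≤ lam i ∧ lam i ≤ L := by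
    intro i hi
    have hi' : 0 < lam i := by simpa [hs] using hi
    have h1 := hgap _ (hlam i)
    have h2 := (hlam i).abs_le hAL
    rw [abs_of_pos hi'] at h1 h2
    exact ⟨h1, h2⟩
  have hQ : ∀ i ∈ sᶜ, b ≤ -lam i ∧ -lam i ≤ L := by
    intro i hi
    have hi' : lam i ≤ 0 := by simpa [hs] using hi
    have h1 := hgap _ (hlam i)
    have h2 := (hlam i).abs_le hAL
    rw [abs_of_nonpos hi'] at h1 h2
    exact ⟨h1, h2⟩
  have hcoord2 : ∀ i v, inner ℝ (e i) (v - (1 / L) • A v) = (1 - lam i / L) * inner ℝ (e i) v := by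
    intro i v
    rw [inner_sub_right, inner_smul_right, hcoord]
    ring
  have hinner : ∀ v w, inner ℝ v w = ∑ i, inner ℝ (e i) v * inner ℝ (e i) w := by
    intro v w
    rw [← e.sum_inner_mul_inner v w]
    exact Finset.sum_congr rfl fun i _ => by rw [real_inner_comm]
  have hsplit : ∀ F : Fin n → ℝ, ∑ i, F i = ∑ i ∈ s, F i + ∑ i ∈ sᶜ, F i := fun F =>
    (Finset.sum_add_sum_compl s F).symm
  have hnorm : ∀ v, ‖v‖ ^ 2 = ‖basisProj e s v‖ ^ 2 + ‖basisProj e sᶜ v‖ ^ 2 := fun v => by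
    rw [norm_sq_basisProj, norm_sq_basisProj, ← hsplit, sum_inner_sq_eq_norm_sq]
  have hbL1 : b / L ≤ 1 := (div_le_one hL).2 hbL
  have hle : ∀ (t : Finset (Fin n)) (v w : EuclideanSpace ℝ (Fin n)) (c : ℝ), 0 ≤ c →
      (∀ i ∈ t, |inner ℝ (e i) w| ≤ c * |inner ℝ (e i) v|) →
      ‖basisProj e t w‖ ≤ c * ‖basisProj e t v‖ := by
    intro t v w c hc h
    refine le_of_sq_le_sq ?_ (by positivity)
    rw [mul_pow, norm_sq_basisProj, norm_sq_basisProj, Finset.mul_sum]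
    refine Finset.sum_le_sum fun i hi => ?_
    rw [← sq_abs, ← sq_abs (inner ℝ (e i) v), ← mul_pow]
    exact pow_le_pow_left₀ (abs_nonneg _) (h i hi) 2
  have hge : ∀ (t : Finset (Fin n)) (v w : EuclideanSpace ℝ (Fin n)) (c : ℝ), 0 ≤ c →
      (∀ i ∈ t, c * |inner ℝ (e i) v| ≤ |inner ℝ (e i) w|) →
      c * ‖basisProj e t v‖ ≤ ‖basisProj e t w‖ := by
    intro t v w c hc h
    refine le_of_sq_le_sq ?_ (by positivity)
    rw [mul_pow, norm_sq_basisProj, norm_sq_basisProj, Finset.mul_sum]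
    refine Finset.sum_le_sum fun i hi => ?_
    rw [← sq_abs (inner ℝ (e i) v), ← sq_abs (inner ℝ (e i) w), ← mul_pow]
    exact pow_le_pow_left₀ (by positivity) (h i hi) 2
  refine ⟨basisProj e s, basisProj e sᶜ, ⟨hnorm, ?_, ?_, ?_, ?_, ?_, ?_, ?_, ?_⟩⟩
  · refine fun v => hle _ _ _ _ (by linarith) fun i hi => ?_
    rw [hcoord2, abs_mul]
    have h1 : b / L ≤ lam i / L := by gcongr; exact (hP i hi).1
    have h2 : lam i / L ≤ 1 := (div_le_one hL).2 (hP i hi).2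
    rw [abs_of_nonneg (by linarith : 0 ≤ 1 - lam i / L)]
    gcongr
  · refine fun v => hge _ _ _ _ (by positivity) fun i hi => ?_
    rw [hcoord2, abs_mul]
    have h1 : b / L ≤ -lam i / L := by gcongr; exact (hQ i hi).1
    rw [neg_div] at h1
    have h0 : 0 ≤ b / L := by positivity
    rw [abs_of_nonneg (by linarith : 0 ≤ 1 - lam i / L)]
    gcongr
    linarith
  · intro v
    rw [hinner, hsplit, norm_sq_basisProj, norm_sq_basisProj, Finset.mul_sum, Finset.mul_sum]
    refine add_le_add (Finset.sum_le_sum fun i hi => ?_) (Finset.sum_le_sum fun i hi => ?_)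
    · rw [hcoord2]
      have h1 : b / L ≤ lam i / L := by gcongr; exact (hP i hi).1
      nlinarith [sq_nonneg (inner ℝ (e i) v)]
    · rw [hcoord2]
      have h1 : -lam i / L ≤ 1 := (div_le_one hL).2 (hQ i hi).2
      rw [neg_div] at h1
      nlinarith [sq_nonneg (inner ℝ (e i) v)]
  · refine fun v => hle _ _ _ _ hL.le fun i hi => ?_
    rw [hcoord, abs_mul]
    gcongr
    exact (hlam i).abs_le hAL
  · refine fun v => hge _ _ _ _ hb.le fun i hi => ?_
    rw [hcoord, abs_mul]
    gcongr
    exact hgap _ (hlam i)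
  · intro v
    refine le_of_sq_le_sq ?_ (by positivity)
    rw [mul_pow, ← sum_inner_sq_eq_norm_sq e, ← sum_inner_sq_eq_norm_sq e, Finset.mul_sum]
    refine Finset.sum_le_sum fun i _ => ?_
    rw [hcoord, mul_pow, ← sq_abs (lam i)]
    gcongr
    exact hgap _ (hlam i)
  · intro v m hm
    rw [hinner, hsplit, norm_sq_basisProj, norm_sq_basisProj, Finset.mul_sum, Finset.mul_sum]
    refine add_le_add (Finset.sum_le_sum fun i hi => ?_) (Finset.sum_le_sum fun i hi => ?_)
    · rw [hcoord]
      nlinarith [sq_nonneg (inner ℝ (e i) v), (hP i hi).1]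
    · rw [hcoord]
      nlinarith [sq_nonneg (inner ℝ (e i) v), hm _ (hlam i)]
  · intro h v
    rw [hinner, ← sum_inner_sq_eq_norm_sq e, Finset.mul_sum]
    refine Finset.sum_le_sum fun i hi => ?_
    rw [hcoord]
    have := hgap _ (hlam i)
    rw [abs_of_nonneg (h _ (hlam i))] at this
    nlinarith [sq_nonneg (inner ℝ (e i) v)]

lemma exists_isEigenvalue_neg {A : EuclideanSpace ℝ (Fin n) →L[ℝ] EuclideanSpace ℝ (Fin n)}
    (hA : (A : EuclideanSpace ℝ (Fin n) →ₗ[ℝ] EuclideanSpace ℝ (Fin n)).IsSymmetric)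
    {v : EuclideanSpace ℝ (Fin n)} (hv : inner ℝ v (A v) < 0) :
    ∃ lam : ℝ, lam < 0 ∧ IsEigenvalue A lam := by
  obtain ⟨e, lam, hlam, hcoord⟩ := exists_orthonormalBasis_inner_apply hA
  by_contra! h
  refine hv.not_ge ?_
  rw [← e.sum_inner_mul_inner v]
  refine Finset.sum_nonneg fun i _ => ?_
  rw [hcoord, real_inner_comm]
  have : 0 ≤ lam i := by
    by_contra! hi
    exact h _ hi (hlam i)
  nlinarith [mul_nonneg this (sq_nonneg (inner ℝ (e i) v))]

lemma IsEigenvalue.exists_minimal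
    {A : EuclideanSpace ℝ (Fin n) →L[ℝ] EuclideanSpace ℝ (Fin n)}
    {lam : ℝ} (h : IsEigenvalue A lam) :
    ∃ m, IsEigenvalue A m ∧ ∀ l, IsEigenvalue A l → m ≤ l := by
  have hfin : {l : ℝ | IsEigenvalue A l}.Finite :=
    Module.End.finite_hasEigenvalue (A : Module.End ℝ (EuclideanSpace ℝ (Fin n)))
  obtain ⟨m, hm, hm2⟩ := Set.exists_min_image _ id hfin ⟨lam, h⟩
  exact ⟨m, hm, hm2⟩

end CCRGD

/-! ### Cone dynamics for scalar sequences with jumps. -/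

namespace CCRGD

/-- Here `a`, `b`, `G` model the norms of P∇f, Q∇f and ∇f. Inside the cone c·G ≤ (1 + c)b, so the
error ηG is absorbed by half of the expansion: `h2` preserves growth, `h1` preserves the cone. -/
lemma cone_step {κ η c a b a' b' G : ℝ} (hκ : κ ≤ 1) (hη : 0 ≤ η)
    (hc : 0 < c) (h1 : η * (1 + c) ≤ κ / 2) (h2 : η * (1 + c) ≤ c * κ / 2)
    (hb : 0 ≤ b) (hG : G ≤ a + b)
    (ha' : a' ≤ (1 - κ) * a + η * G) (hb' : (1 + κ) * b - η * G ≤ b') (hcone : c * a ≤ b) :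
    (1 + κ / 2) * b ≤ b' ∧ c * a' ≤ b' := by
  have hcG : c * G ≤ (1 + c) * b := by nlinarith
  have h3 : c * (η * G) ≤ c * (κ / 2 * b) := by
    calc c * (η * G) = η * (c * G) := by ring
      _ ≤ η * ((1 + c) * b) := by gcongr
      _ = η * (1 + c) * b := by ring
      _ ≤ c * κ / 2 * b := by gcongr
      _ = c * (κ / 2 * b) := by ring
  have h3' : η * G ≤ κ / 2 * b := le_of_mul_le_mul_left h3 hc
  have h4 : c * (η * G) ≤ κ / 2 * b := by
    calc c * (η * G) = η * (c * G) := by ring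
      _ ≤ η * ((1 + c) * b) := by gcongr
      _ = η * (1 + c) * b := by ring
      _ ≤ κ / 2 * b := by gcongr
  have h5 : (1 - κ) * (c * a) ≤ (1 - κ) * b := by
    apply mul_le_mul_of_nonneg_left hcone (by linarith)
  refine ⟨by linarith, ?_⟩
  have h6 : c * a' ≤ c * ((1 - κ) * a + η * G) := by gcongr
  have h7 : 0 ≤ κ * b := by
    have : 0 ≤ η * (1 + c) := by positivity
    have : 0 ≤ κ := by linarith
    positivity
  nlinarith

/-- A trajectory that stays bounded never enters the expanding cone. -/
lemma le_of_bounded_of_expanding {κ η c B : ℝ} (hκ0 : 0 < κ) (hκ : κ ≤ 1) (hη : 0 ≤ η)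
    (hc : 0 < c) (h1 : η * (1 + c) ≤ κ / 2) (h2 : η * (1 + c) ≤ c * κ / 2)
    {a b G : ℕ → ℝ} (ha : ∀ k, 0 ≤ a k) (hG : ∀ k, G k ≤ a k + b k) (hbB : ∀ k, b k ≤ B)
    (ha' : ∀ k, a (k + 1) ≤ (1 - κ) * a k + η * G k)
    (hb' : ∀ k, (1 + κ) * b k - η * G k ≤ b (k + 1)) (k : ℕ) : b k ≤ c * a k := by
  by_contra! hk
  have hbk : 0 < b k := lt_of_le_of_lt (mul_nonneg hc.le (ha k)) hk
  have key : ∀ j, c * a (k + j) ≤ b (k + j) ∧ (1 + κ / 2) ^ j * b k ≤ b (k + j) := by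
    intro j
    induction j with
    | zero => simpa using hk.le
    | succ j ih =>
      have hpos : 0 ≤ b (k + j) := le_trans (by positivity) ih.2
      have h := cone_step hκ hη hc h1 h2 hpos (hG _) (ha' _) (hb' _) ih.1
      refine ⟨h.2, le_trans ?_ h.1⟩
      rw [pow_succ', mul_assoc]
      gcongr
      exact ih.2
  obtain ⟨j, hj⟩ := pow_unbounded_of_one_lt (B / b k) (by linarith : 1 < 1 + κ / 2)
  rw [div_lt_iff₀ hbk] at hj
  linarith [(key j).2, hbB (k + j)]

lemma tendsto_zero_of_le_mul {q : ℝ} (hq0 : 0 ≤ q) (hq : q < 1) {a : ℕ → ℝ} (ha : ∀ k, 0 ≤ a k)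
    (h : ∀ k, a (k + 1) ≤ q * a k) : Tendsto a atTop (𝓝 0) := by
  have key : ∀ k, a k ≤ q ^ k * a 0 := by
    intro k
    induction k with
    | zero => simp
    | succ k ih =>
      rw [pow_succ', mul_assoc]
      exact (h k).trans (by gcongr)
  refine squeeze_zero ha key ?_
  simpa using (tendsto_pow_atTop_nhds_zero_of_lt_one hq0 hq).mul_const (a 0)

/-- The number s/(1 - q) is the fixed point of u ↦ qu + s, and the positive part of the excess over
it contracts by q. -/
lemma eventually_le_of_le_mul_add {q s : ℝ} (hq0 : 0 ≤ q) (hq : q < 1) (hs : 0 < s) {u : ℕ → ℝ}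
    (h : ∀ k, u (k + 1) ≤ q * u k + s) : ∀ᶠ k in atTop, u k ≤ 2 * (s / (1 - q)) := by
  have hpos : 0 < s / (1 - q) := div_pos hs (by linarith)
  have hfix : q * (s / (1 - q)) + s = s / (1 - q) := by
    have : 1 - q ≠ 0 := by linarith
    field_simp
    ring
  have ht := tendsto_zero_of_le_mul hq0 hq (a := fun k => max (u k - s / (1 - q)) 0)
    (fun k => le_max_right _ _) (fun k => by
      refine max_le ?_ (by positivity)
      have : q * (u k - s / (1 - q)) ≤ q * max (u k - s / (1 - q)) 0 := by
        gcongr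
        exact le_max_left _ _
      linarith [h k])
  filter_upwards [ht.eventually (gt_mem_nhds hpos)] with k hk
  linarith [le_max_left (u k - s / (1 - q)) 0]

/-- If the size of a flagged process is eventually small, there is a last time at which the
flag is off and from which on the size is small. -/
lemma exists_last_unflagged {e : ℝ} {G : ℕ → ℝ} {Ξ : ℕ → Bool} (h0 : Ξ 0 = false)
    (hbig : ∀ k, e < G k → Ξ (k + 1) = false) (hsmall : ∃ N, ∀ k ≥ N, G k ≤ e) :
    ∃ K, Ξ K = false ∧ ∀ k ≥ K, G k ≤ e := by
  classical
  obtain hN := Nat.find_spec hsmall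
  rcases Nat.eq_zero_or_pos (Nat.find hsmall) with hz | hpos
  · exact ⟨0, h0, fun k _ => hN k (by omega)⟩
  · refine ⟨Nat.find hsmall, ?_, hN⟩
    -- By minimality the size still exceeds `e` one step before the least such time, and that step
    -- switches the flag off.
    have hmin := Nat.find_min hsmall (m := Nat.find hsmall - 1) (by omega)
    push Not at hmin
    obtain ⟨k, hk, hk2⟩ := hmin
    have : k = Nat.find hsmall - 1 := by
      by_contra hne
      exact absurd (hN k (by omega)) (not_le.2 hk2)
    have h := hbig k hk2
    rwa [this, Nat.sub_add_cancel hpos] at h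

/-- An infinite number of jumps is impossible for a process with a contracting part `a`, which
jumps change only slightly, and an expanding part `b`. -/
lemma exists_forall_not_jump {κ η η₂ e : ℝ} (hκ0 : 0 < κ) (hκ : κ ≤ 1) (hη : 0 ≤ η)
    (hηη : η ≤ η₂) (hη₂ : 0 < η₂) (hsm : η₂ * (1 + 2 / κ) ≤ κ / 32) (he : 0 < e)
    {a b G : ℕ → ℝ} {Ξ : ℕ → Bool} {J : ℕ → Prop}
    (ha : ∀ k, 0 ≤ a k) (hb : ∀ k, 0 ≤ b k) (hG : ∀ k, G k ≤ a k + b k) (hbG : ∀ k, b k ≤ G k)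
    (ha' : ∀ k, ¬ J k → a (k + 1) ≤ (1 - κ) * a k + η * G k)
    (hb' : ∀ k, ¬ J k → (1 + κ) * b k - η * G k ≤ b (k + 1))
    (hJ : ∀ k, J k → G k ≤ e ∧ Ξ k = false ∧ Ξ (k + 1) = true ∧ a (k + 1) ≤ a k + η₂ * G k)
    (hflag : ∀ k, G k ≤ e → Ξ (k + 1) = true) :
    ∃ N, ∀ k ≥ N, ¬ J k := by
  by_contra! hinf
  set C : ℝ := 1 + 2 / κ with hC
  have hC1 : 1 ≤ C := by
    have : 0 ≤ 2 / κ := by positivity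
    linarith
  have hηC : η * C ≤ κ / 32 := le_trans (by gcongr) hsm
  -- In the narrow unstable cone a ≤ (κ/2)b, the whole size G is nondecreasing: G ≤ (1 + κ/2)b,
  -- which is at most the next b.
  have hgrow : ∀ k, ¬ J k → 2 * a k ≤ κ * b k →
      2 * a (k + 1) ≤ κ * b (k + 1) ∧ G k ≤ G (k + 1) := by
    intro k hk h
    have h1 : 2 / κ * a k ≤ b k := by
      rw [div_mul_eq_mul_div, div_le_iff₀ hκ0]
      linarith
    have h2 : 1 ≤ 2 / κ := by
      rw [le_div_iff₀ hκ0]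
      linarith
    have h3 := cone_step (c := 2 / κ) hκ hη (by positivity) (by linarith)
      (by
        have : κ / 2 ≤ 2 / κ * κ / 2 := by
          have : 1 * (κ / 2) ≤ 2 / κ * (κ / 2) := by gcongr
          linarith
        linarith) (hb k) (hG k) (ha' k hk) (hb' k hk) h1
    refine ⟨?_, ?_⟩
    · have h4 := h3.2
      rw [div_mul_eq_mul_div, div_le_iff₀ hκ0] at h4
      linarith
    · have h4 := hG k
      have h5 := hbG (k + 1)
      linarith [h3.1]
  -- Hence a state in this cone from which a jump still lies ahead already has G ≤ e; outside the
  -- cone G is controlled by `a`.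
  have hret : ∀ d k, J (k + d) → 2 * a k ≤ κ * b k → G k ≤ e := by
    intro d
    induction d with
    | zero => exact fun k hk _ => (hJ k hk).1
    | succ d ih =>
      intro k hk hcone
      by_cases hJk : J k
      · exact (hJ k hJk).1
      · have h := hgrow k hJk hcone
        exact h.2.trans (ih (k + 1) (by rwa [add_assoc, add_comm 1 d]) h.1)
  have hcase : ∀ k, G k ≤ e ∨ G k ≤ C * a k := by
    intro k
    by_cases hcone : 2 * a k ≤ κ * b k
    · obtain ⟨l, hl, hl2⟩ := hinf k
      obtain ⟨d, rfl⟩ := Nat.exists_eq_add_of_le hl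
      exact Or.inl (hret d k hl2 hcone)
    · right
      have : b k ≤ 2 / κ * a k := by
        rw [div_mul_eq_mul_div, le_div_iff₀ hκ0]
        linarith
      rw [hC]
      linarith [hG k]
  have hGC : ∀ k, G k ≤ C * a k + e := by
    intro k
    have : 0 ≤ C * a k := mul_nonneg (by linarith) (ha k)
    rcases hcase k with h | h <;> linarith
  set τ : ℝ := 1 - κ / 4 with hτ
  have hτ0 : 0 < τ := by linarith
  -- A jump turns the flag on, so the discount τ outweighs the small growth of `a` at jumps. When
  -- the flag is turned off again the discount is lost, but that happens at a gradient step, whose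
  -- contraction pays for it.
  set Ψ : ℕ → ℝ := fun k => if Ξ k = true then τ * a k else a k with hΨ
  have hΨ1 : ∀ k, τ * a k ≤ Ψ k := by
    intro k
    simp only [hΨ]
    split_ifs
    · exact le_rfl
    · nlinarith [ha k]
  have hΨ2 : ∀ k, Ψ k ≤ a k := by
    intro k
    simp only [hΨ]
    split_ifs
    · nlinarith [ha k]
    · exact le_rfl
  have hrec : ∀ k, Ψ (k + 1) ≤ (1 - κ / 8) * Ψ k + η₂ * e := by
    intro k
    have hee : η * e ≤ η₂ * e := by gcongr
    have hak := ha k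
    by_cases hJk : J k
    · obtain ⟨h1, h2, h3, h4⟩ := hJ k hJk
      have e1 : Ψ (k + 1) = τ * a (k + 1) := by simp [hΨ, h3]
      have e2 : Ψ k = a k := by simp [hΨ, h2]
      rw [e1, e2]
      have h5 : η₂ * G k ≤ η₂ * (C * a k + e) := by
        gcongr
        exact hGC k
      have h6 : η₂ * C * a k ≤ κ / 32 * a k := by gcongr
      have h7 : a (k + 1) ≤ (1 + κ / 32) * a k + η₂ * e := by linarith
      have h8 : τ * a (k + 1) ≤ τ * ((1 + κ / 32) * a k + η₂ * e) := by gcongr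
      have h9 : τ * (η₂ * e) ≤ 1 * (η₂ * e) := by gcongr; linarith
      have h10 : τ * (1 + κ / 32) ≤ 1 - κ / 8 := by
        rw [hτ]
        nlinarith
      have h11 : τ * (1 + κ / 32) * a k ≤ (1 - κ / 8) * a k := by gcongr
      linarith
    · have h5 : η * G k ≤ η * (C * a k + e) := by
        gcongr
        exact hGC k
      have h6 : η * C * a k ≤ κ / 32 * a k := by gcongr
      have h7 : a (k + 1) ≤ (1 - κ / 2) * a k + η * e := by nlinarith [ha' k hJk]
      have h8 : (1 - κ / 2) * a k ≤ (1 - κ / 8) * (τ * a k) := by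
        rw [hτ, ← mul_assoc]
        gcongr
        nlinarith
      have h9 : (1 - κ / 8) * (τ * a k) ≤ (1 - κ / 8) * Ψ k := by
        have : 0 ≤ 1 - κ / 8 := by linarith
        gcongr
        exact hΨ1 k
      linarith [hΨ2 (k + 1)]
  have hev := eventually_le_of_le_mul_add (by linarith) (by linarith) (by positivity) hrec
  obtain ⟨N, hN⟩ := eventually_atTop.1 hev
  -- Without G > e the flag would stay on and block the later jumps. But at such a time G ≤ C·a,
  -- while `a` has become too small for this to exceed e.
  have hbig : ∃ m ≥ N, e < G m := by
    by_contra! hall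
    obtain ⟨l, hl, hl2⟩ := hinf (N + 1)
    have h1 := hflag (l - 1) (hall _ (by omega))
    rw [Nat.sub_add_cancel (by omega), (hJ l hl2).2.1] at h1
    exact absurd h1 (by decide)
  obtain ⟨m, hm, hme⟩ := hbig
  have h1 : G m ≤ C * a m := by
    rcases hcase m with h | h
    · exact absurd h (not_le.2 hme)
    · exact h
  have h2 := hN m hm
  have h3 : 2 * (η₂ * e / (1 - (1 - κ / 8))) = 16 * (η₂ * e) / κ := by
    rw [sub_sub_cancel]
    field_simp
    ring
  rw [h3, le_div_iff₀ hκ0] at h2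
  have h4 : 3 / 4 * a m ≤ Ψ m := le_trans (by have := ha m; gcongr; linarith) (hΨ1 m)
  have h5 : e < C * a m := by linarith
  have h6 : 3 / 4 * a m * κ ≤ 16 * (η₂ * e) := le_trans (by gcongr) h2
  have h7 : C * (3 / 4 * a m * κ) ≤ C * (16 * (η₂ * e)) := by gcongr
  have h8 : η₂ * C * (16 * e) ≤ κ / 32 * (16 * e) := by gcongr
  have h9 : κ * e < κ * (C * a m) := by gcongr
  nlinarith

/-- Once the jumps have ended, the run lies in the stable cone and `a`, hence G, tends to 0, so a
last unflagged entry time K into G ≤ e exists. The flag is on from K + 1, so no jump follows;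
boundedness then forces the stable cone from K + 1, and already at K if K is not a jump. -/
lemma exists_last_entry {κ η η₂ e c B : ℝ} (hκ0 : 0 < κ) (hκ : κ ≤ 1) (hη : 0 ≤ η)
    (hηη : η ≤ η₂) (hη₂ : 0 < η₂) (hsm : η₂ * (1 + 2 / κ) ≤ κ / 32) (he : 0 < e)
    (hc : 0 < c) (hc1 : η * (1 + c) ≤ κ / 2) (hc2 : η * (1 + c) ≤ c * κ / 2)
    {a b G : ℕ → ℝ} {Ξ : ℕ → Bool} {J : ℕ → Prop}
    (ha : ∀ k, 0 ≤ a k) (hb : ∀ k, 0 ≤ b k) (hG : ∀ k, G k ≤ a k + b k) (hbG : ∀ k, b k ≤ G k)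
    (hbB : ∀ k, b k ≤ B)
    (ha' : ∀ k, ¬ J k → a (k + 1) ≤ (1 - κ) * a k + η * G k)
    (hb' : ∀ k, ¬ J k → (1 + κ) * b k - η * G k ≤ b (k + 1))
    (hJ : ∀ k, J k → G k ≤ e ∧ Ξ k = false ∧ Ξ (k + 1) = true ∧ a (k + 1) ≤ a k + η₂ * G k)
    (hflag : ∀ k, G k ≤ e → Ξ (k + 1) = true) (hbig : ∀ k, e < G k → Ξ (k + 1) = false)
    (h0 : Ξ 0 = false) :
    ∃ K, Ξ K = false ∧ (∀ k ≥ K, G k ≤ e) ∧ b (K + 1) ≤ c * a (K + 1) ∧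
      (¬ J K → b K ≤ c * a K) := by
  have htail : ∀ N, (∀ k ≥ N, ¬ J k) → ∀ k ≥ N, b k ≤ c * a k := by
    intro N hN k hk
    have h := le_of_bounded_of_expanding hκ0 hκ hη hc hc1 hc2 (a := fun k => a (N + k))
      (b := fun k => b (N + k)) (G := fun k => G (N + k)) (fun k => ha _) (fun k => hG _)
      (fun k => hbB _) (fun k => ha' _ (hN _ (Nat.le_add_right N k)))
      (fun k => hb' _ (hN _ (Nat.le_add_right N k)))
      (k - N)
    simpa [Nat.add_sub_cancel' hk] using h
  obtain ⟨N, hN⟩ := exists_forall_not_jump hκ0 hκ hη hηη hη₂ hsm he ha hb hG hbG ha' hb' hJ hflag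
  have hGa : ∀ k ≥ N, G k ≤ (1 + c) * a k := fun k hk => by
    linarith [hG k, htail N hN k hk]
  have hlim : Tendsto (fun k => a (N + k)) atTop (𝓝 0) := by
    refine tendsto_zero_of_le_mul (q := 1 - κ / 2) (by linarith) (by linarith) (fun k => ha _) ?_
    intro k
    have h1 := ha' (N + k) (hN _ (by omega))
    have h2 : η * G (N + k) ≤ η * ((1 + c) * a (N + k)) := by
      gcongr
      exact hGa _ (by omega)
    have h3 : η * (1 + c) * a (N + k) ≤ κ / 2 * a (N + k) := by
      have := ha (N + k)
      gcongr
    rw [← add_assoc]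
    linarith
  have hsmall : ∃ N', ∀ k ≥ N', G k ≤ e := by
    have hpos : 0 < e / (1 + c) := by positivity
    obtain ⟨N', hN'⟩ := eventually_atTop.1 (hlim.eventually (gt_mem_nhds hpos))
    refine ⟨N + N', fun k hk => ?_⟩
    have h1 := hN' (k - N) (by omega)
    rw [Nat.add_sub_cancel' (by omega), lt_div_iff₀ (by positivity)] at h1
    linarith [hGa k (by omega)]
  obtain ⟨K, hK, hK2⟩ := exists_last_unflagged h0 hbig hsmall
  have hKJ : ∀ k ≥ K + 1, ¬ J k := by
    intro k hk hJk
    have h1 := hflag (k - 1) (hK2 _ (by omega))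
    rw [Nat.sub_add_cancel (by omega), (hJ k hJk).2.1] at h1
    exact absurd h1 (by decide)
  refine ⟨K, hK, hK2, htail _ hKJ _ le_rfl, fun hJK => htail K (fun k hk => ?_) K le_rfl⟩
  rcases Nat.eq_or_lt_of_le hk with h | h
  · rwa [← h]
  · exact hKJ k h

end CCRGD

/-! ### Hyperbolic estimates near a nondegenerate critical point. -/

namespace CCRGD

variable {n : ℕ} {f : EuclideanSpace ℝ (Fin n) → ℝ} {L M β b r σ c ε Pmin : ℝ}

/-- The regularity assumptions: `f` is `C²`, its gradient is `L`-Lipschitz and its Hessian is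
`M`-Lipschitz. -/
structure IsRegular (f : EuclideanSpace ℝ (Fin n) → ℝ) (L M : ℝ) : Prop where
  L_pos : 0 < L
  M_pos : 0 < M
  contDiff : ContDiff ℝ 2 f
  gradient_lip : ∀ x y, ‖gradient f x - gradient f y‖ ≤ L * ‖x - y‖
  hessian_lip : ∀ x y, ‖hessian f x - hessian f y‖ ≤ M * ‖x - y‖

/-- Constants for which the hyperbolic estimates hold on the ball of radius `r` around a critical
point whose Hessian has eigenvalues of absolute value at least `b > β`. The number `σ` bounds the
contracting part of a curvature step, and `c` is the opening of the stable cone. -/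
structure IsAdmissible (L M β b r σ c : ℝ) : Prop where
  β_pos : 0 < β
  β_lt : β < b
  b_le : b ≤ L
  r_pos : 0 < r
  σ_pos : 0 < σ
  c_pos : 0 < c
  jump_small : (L * σ + 2 * M * r) / β * (1 + 2 / (b / L)) ≤ b / L / 32
  cone_left : 2 * M * r / L * (1 + c) ≤ b / L / 2
  cone_right : 2 * M * r / L * (1 + c) ≤ c * (b / L) / 2
  stable : 2 * c ^ 2 + 2 * M * r / L ≤ (b - β) / L
  radius : 2 * M * r ≤ b - β
  jump_large : c * (1 + (L * σ + 2 * M * r) / β) < (b - b * σ - 2 * M * r) / β - 1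
  deviation : M * r ≤ b * σ ^ 2

/-- First c is chosen small, using b > β. Then σ = t and r = bt²/M make Mr = bσ² exactly, and every
other condition becomes a strict inequality at t = 0, so it persists for small t > 0. -/
lemma exists_isAdmissible (hL : 0 < L) (hM : 0 < M) (hβ : 0 < β) (hβb : β < b) (hbL : b ≤ L) :
    ∃ r σ c, IsAdmissible L M β b r σ c := by
  have hb : 0 < b := hβ.trans hβb
  have hev : ∀ {F : ℝ → ℝ} {y : ℝ}, Continuous F → F 0 < y → ∀ᶠ t in 𝓝[>] (0 : ℝ), F t < y :=
    fun hF h => (hF.continuousAt.eventually (gt_mem_nhds h)).filter_mono nhdsWithin_le_nhds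
  have hgap : 0 < (b - β) / L := div_pos (by linarith) hL
  have hgap2 : 0 < b / β - 1 := by
    rw [sub_pos, one_lt_div hβ]
    exact hβb
  have hκ : 0 < b / L := by positivity
  obtain ⟨c, ⟨hc1, hc2⟩, hc0⟩ :=
    (((hev (F := fun c : ℝ => 2 * c ^ 2) (by fun_prop) (by simpa using hgap)).and
      (hev (F := fun c : ℝ => c) (by fun_prop) hgap2)).and self_mem_nhdsWithin).exists
  have hc0 : 0 < c := hc0
  obtain ⟨t, ⟨⟨⟨⟨⟨⟨h1, h2⟩, h3⟩, h4⟩, h5⟩, h6⟩, ht⟩⟩ :=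
    (((((((hev (F := fun t : ℝ => (L * t + 2 * (b * t ^ 2)) / β * (1 + 2 / (b / L))) (by fun_prop)
      (y := b / L / 32) (by simpa using by positivity)).and
      (hev (F := fun t : ℝ => 2 * (b * t ^ 2) / L * (1 + c)) (by fun_prop)
        (y := b / L / 2) (by simpa using by positivity))).and
      (hev (F := fun t : ℝ => 2 * (b * t ^ 2) / L * (1 + c)) (by fun_prop)
        (y := c * (b / L) / 2) (by simpa using by positivity))).and
      (hev (F := fun t : ℝ => 2 * c ^ 2 + 2 * (b * t ^ 2) / L) (by fun_prop)
        (y := (b - β) / L) (by simpa using hc1))).and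
      (hev (F := fun t : ℝ => 2 * (b * t ^ 2)) (by fun_prop)
        (y := b - β) (by simpa using hβb))).and
      (hev (F := fun t : ℝ => c * (1 + (L * t + 2 * (b * t ^ 2)) / β) -
          ((b - b * t - 2 * (b * t ^ 2)) / β - 1)) (by fun_prop)
        (y := 0) (by simpa using hc2))).and self_mem_nhdsWithin).exists
  have ht : 0 < t := ht
  have e : M * (b * t ^ 2 / M) = b * t ^ 2 := mul_div_cancel₀ _ hM.ne'
  refine ⟨b * t ^ 2 / M, t, c, hβ, hβb, hbL, by positivity, ht, hc0, ?_, ?_, ?_, ?_, ?_, ?_, e.le⟩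
    <;> rw [mul_assoc 2 M, e]
  · exact h1.le
  · exact h2.le
  · exact h3.le
  · exact h4.le
  · exact h5.le
  · exact sub_neg.1 h6

namespace IsSplitting

variable {A P Q : EuclideanSpace ℝ (Fin n) →L[ℝ] EuclideanSpace ℝ (Fin n)}

lemma norm_P_le_norm (h : IsSplitting A L b P Q) (v : EuclideanSpace ℝ (Fin n)) :
    ‖P v‖ ≤ ‖v‖ :=
  le_of_sq_le_sq (by nlinarith [h.norm_sq v, sq_nonneg ‖Q v‖]) (norm_nonneg _)

lemma norm_Q_le_norm (h : IsSplitting A L b P Q) (v : EuclideanSpace ℝ (Fin n)) :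
    ‖Q v‖ ≤ ‖v‖ :=
  le_of_sq_le_sq (by nlinarith [h.norm_sq v, sq_nonneg ‖P v‖]) (norm_nonneg _)

lemma norm_le_add (h : IsSplitting A L b P Q) (v : EuclideanSpace ℝ (Fin n)) :
    ‖v‖ ≤ ‖P v‖ + ‖Q v‖ := by
  refine le_of_sq_le_sq ?_ (by positivity)
  rw [h.norm_sq]
  nlinarith [norm_nonneg (P v), norm_nonneg (Q v)]

end IsSplitting

section Local

variable {p x z : EuclideanSpace ℝ (Fin n)}
  {P Q : EuclideanSpace ℝ (Fin n) →L[ℝ] EuclideanSpace ℝ (Fin n)}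

lemma IsRegular.norm_gradient_le (hreg : IsRegular f L M) (hp : gradient f p = 0)
    (x : EuclideanSpace ℝ (Fin n)) : ‖gradient f x‖ ≤ L * ‖x - p‖ := by
  simpa [hp] using hreg.gradient_lip x p

lemma IsRegular.norm_gradStep_sub_le (hreg : IsRegular f L M) (hp : gradient f p = 0)
    (x : EuclideanSpace ℝ (Fin n)) : ‖gradStep f L x - p‖ ≤ 2 * ‖x - p‖ := by
  have h1 : ‖gradStep f L x - x‖ ≤ ‖x - p‖ := by
    rw [norm_gradStep_sub hreg.L_pos, div_le_iff₀ hreg.L_pos, mul_comm]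
    exact hreg.norm_gradient_le hp x
  have h2 := norm_sub_le_norm_sub_add_norm_sub (gradStep f L x) x p
  linarith

/-- The Hessian comparison is made on the ball of radius 2r, since a gradient step at most doubles
the distance to p; this is the origin of the factor 2 in the error. -/
lemma IsRegular.norm_gradient_gradStep_sub_le (hreg : IsRegular f L M) (hp : gradient f p = 0)
    (hx : ‖x - p‖ ≤ r) :
    ‖gradient f (gradStep f L x) - (gradient f x - (1 / L) • hessian f p (gradient f x))‖ ≤
      2 * M * r / L * ‖gradient f x‖ := by
  have hr : 0 ≤ r := (norm_nonneg _).trans hx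
  have h := norm_gradient_sub_sub_hessian_le hreg.contDiff hreg.M_pos.le hreg.hessian_lip
    (p := p) (x := x) (y := gradStep f L x) (R := 2 * r) (by linarith)
    ((hreg.norm_gradStep_sub_le hp x).trans (by linarith))
  rw [norm_gradStep_sub hreg.L_pos, gradStep_sub, map_neg, map_smul] at h
  convert h using 1
  · congr 1
    abel
  · ring

lemma IsRegular.contract (hreg : IsRegular f L M) (hp : gradient f p = 0)
    (hs : IsSplitting (hessian f p) L b P Q) (hx : ‖x - p‖ ≤ r) :
    ‖P (gradient f (gradStep f L x))‖ ≤
      (1 - b / L) * ‖P (gradient f x)‖ + 2 * M * r / L * ‖gradient f x‖ := by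
  have h1 := hs.contract (gradient f x)
  have h2 := (hs.norm_P_le_norm _).trans (hreg.norm_gradient_gradStep_sub_le hp hx)
  rw [map_sub] at h2
  have h3 := norm_le_norm_add_norm_sub' (P (gradient f (gradStep f L x)))
    (P (gradient f x - (1 / L) • hessian f p (gradient f x)))
  linarith

lemma IsRegular.expand (hreg : IsRegular f L M) (hp : gradient f p = 0)
    (hs : IsSplitting (hessian f p) L b P Q) (hx : ‖x - p‖ ≤ r) :
    (1 + b / L) * ‖Q (gradient f x)‖ - 2 * M * r / L * ‖gradient f x‖ ≤
      ‖Q (gradient f (gradStep f L x))‖ := by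
  have h1 := hs.expand (gradient f x)
  have h2 := (hs.norm_Q_le_norm _).trans (hreg.norm_gradient_gradStep_sub_le hp hx)
  rw [map_sub] at h2
  have h3 := norm_le_norm_add_norm_sub (Q (gradient f (gradStep f L x)))
    (Q (gradient f x - (1 / L) • hessian f p (gradient f x)))
  linarith

lemma IsRegular.inner_gradient_gradStep_le (hreg : IsRegular f L M) (hp : gradient f p = 0)
    (hx : ‖x - p‖ ≤ r) :
    inner ℝ (gradient f x) (gradient f (gradStep f L x)) ≤
      inner ℝ (gradient f x) (gradient f x - (1 / L) • hessian f p (gradient f x)) +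
        2 * M * r / L * ‖gradient f x‖ ^ 2 := by
  have h2 := hreg.norm_gradient_gradStep_sub_le hp hx
  have h3 := real_inner_le_norm (gradient f x) (gradient f (gradStep f L x) -
    (gradient f x - (1 / L) • hessian f p (gradient f x)))
  rw [inner_sub_right] at h3
  have h4 : ‖gradient f x‖ * ‖gradient f (gradStep f L x) -
      (gradient f x - (1 / L) • hessian f p (gradient f x))‖ ≤
      ‖gradient f x‖ * (2 * M * r / L * ‖gradient f x‖) := by gcongr
  nlinarith

/-- Nondegeneracy makes the gradient control the distance to p, with β left over from b after the
linearization error. The radius 2r also covers the first gradient iterate outside the ball. -/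
lemma IsRegular.mul_norm_sub_le (hreg : IsRegular f L M) (hp : gradient f p = 0)
    (hs : IsSplitting (hessian f p) L b P Q) (hr : 2 * M * r ≤ b - β) (hx : ‖x - p‖ ≤ 2 * r) :
    β * ‖x - p‖ ≤ ‖gradient f x‖ := by
  have hr0 : 0 ≤ 2 * r := (norm_nonneg _).trans hx
  have h1 := norm_gradient_sub_sub_hessian_le hreg.contDiff hreg.M_pos.le hreg.hessian_lip
    (p := p) (x := p) (y := x) (R := 2 * r) (by simpa using hr0) hx
  rw [hp, sub_zero] at h1
  have h2 := hs.le_norm (x - p)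
  have h3 := norm_le_norm_add_norm_sub (gradient f x) (hessian f p (x - p))
  have h4 : M * (2 * r) * ‖x - p‖ ≤ (b - β) * ‖x - p‖ := by
    gcongr
    linarith
  linarith

lemma IsRegular.abs_inner_hessian_sub_le (hreg : IsRegular f L M) (hx : ‖x - p‖ ≤ r)
    (v : EuclideanSpace ℝ (Fin n)) :
    |inner ℝ v (hessian f x v) - inner ℝ v (hessian f p v)| ≤ M * r * ‖v‖ ^ 2 := by
  rw [← inner_sub_right, ← sub_apply]
  refine (abs_real_inner_le_norm _ _).trans ?_
  have h1 : ‖hessian f x - hessian f p‖ ≤ M * r :=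
    (hreg.hessian_lip x p).trans (mul_le_mul_of_nonneg_left hx hreg.M_pos.le)
  have h2 := (hessian f x - hessian f p).le_of_opNorm_le h1 v
  calc ‖v‖ * ‖(hessian f x - hessian f p) v‖ ≤ ‖v‖ * (M * r * ‖v‖) := by gcongr
    _ = M * r * ‖v‖ ^ 2 := by ring

lemma inner_scaledHessian (x v : EuclideanSpace ℝ (Fin n)) :
    inner ℝ v (scaledHessian f L x v) = 1 / L * inner ℝ v (hessian f x v) := by
  rw [scaledHessian, smul_apply, inner_smul_right]

/-- Compare the minimizer with a vector of the same length ρ along the lowest eigenvector of ∇²f(p),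
of eigenvalue m ≤ -b. Replacing ∇²f(x) by ∇²f(p) costs 2Mrρ², while a P-component costs (b - m)‖Pv‖²
≥ 2b‖Pv‖². -/
lemma IsRegular.norm_P_curvatureStep_le (hreg : IsRegular f L M)
    (hs : IsSplitting (hessian f p) L b P Q)
    (hgap : ∀ lam, IsEigenvalue (hessian f p) lam → b ≤ |lam|)
    (hneg : ∃ lam < 0, IsEigenvalue (hessian f p) lam) (hb : 0 < b)
    (hσ : 0 ≤ σ) (hdev : M * r ≤ b * σ ^ 2) (hβ : 0 < β)
    (hx : ‖x - p‖ ≤ r) (hz : z ∈ curvatureSteps f L β x) :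
    ‖P (z - x)‖ ≤ σ * (‖gradient f x‖ / β) := by
  obtain ⟨lam, hlam0, hlam⟩ := hneg
  obtain ⟨m, hm, hmin⟩ := hlam.exists_minimal
  have hmb : m ≤ -b := by
    have h1 := hgap m hm
    rw [abs_of_neg ((hmin lam hlam).trans_lt hlam0)] at h1
    linarith
  obtain ⟨e, he, he2⟩ := hm.exists_eq_smul
  set ρ := ‖gradient f x‖ / β with hρ
  have hρ0 : 0 ≤ ρ := by positivity
  obtain ⟨hz1, hz2⟩ := hz
  have hv : ‖z - x‖ = ρ := by simpa [mem_sphere_iff_norm] using hz1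
  have hw : ‖ρ • e‖ = ρ := by rw [norm_smul, he, mul_one, Real.norm_of_nonneg hρ0]
  have h1 : (1 / 2 : ℝ) * inner ℝ (z - x) (scaledHessian f L x (z - x)) ≤
      1 / 2 * inner ℝ (ρ • e) (scaledHessian f L x (ρ • e)) := by
    have := hz2 (show x + ρ • e ∈ _ by simpa [mem_sphere_iff_norm] using hw)
    simpa only [Set.mem_ofPred_eq, add_sub_cancel_left] using this
  rw [inner_scaledHessian, inner_scaledHessian] at h1
  have hL := hreg.L_pos
  have h2 : inner ℝ (z - x) (hessian f x (z - x)) ≤ inner ℝ (ρ • e) (hessian f x (ρ • e)) := by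
    have hL' : 0 < 1 / L := by positivity
    nlinarith
  have h3 := (abs_le.1 (hreg.abs_inner_hessian_sub_le hx (z - x))).1
  have h4 := (abs_le.1 (hreg.abs_inner_hessian_sub_le hx (ρ • e))).2
  have h5 : inner ℝ (ρ • e) (hessian f p (ρ • e)) = m * ρ ^ 2 := by
    rw [map_smul, he2, smul_comm, inner_smul_right, real_inner_self_eq_norm_sq, hw]
  have h6 := hs.le_inner (z - x) m hmin
  have h7 := hs.norm_sq (z - x)
  rw [hv] at h3 h7
  rw [hw] at h4
  have h9 : M * r * ρ ^ 2 ≤ b * σ ^ 2 * ρ ^ 2 := by gcongr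
  have h10 : 2 * b * ‖P (z - x)‖ ^ 2 ≤ (b - m) * ‖P (z - x)‖ ^ 2 := by
    gcongr
    linarith
  refine le_of_sq_le_sq ?_ (by positivity)
  have h11 : m * ‖Q (z - x)‖ ^ 2 = m * ρ ^ 2 - m * ‖P (z - x)‖ ^ 2 := by rw [h7]; ring
  have h12 : b * ‖P (z - x)‖ ^ 2 ≤ b * (σ * ρ) ^ 2 := by
    rw [mul_pow]
    linarith
  exact le_of_mul_le_mul_left h12 hb

lemma norm_sub_eq_of_mem_curvatureSteps (hz : z ∈ curvatureSteps f L β x) :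
    ‖z - x‖ = ‖gradient f x‖ / β :=
  mem_sphere_iff_norm.1 hz.1

lemma IsRegular.norm_gradient_curvatureStep_sub_le (hreg : IsRegular f L M)
    (hβ : 0 < β) (hx : ‖x - p‖ ≤ r) (hg : ‖gradient f x‖ ≤ β * r)
    (hz : z ∈ curvatureSteps f L β x) :
    ‖gradient f z - gradient f x - hessian f p (z - x)‖ ≤
      2 * M * r * (‖gradient f x‖ / β) := by
  have hzx := norm_sub_eq_of_mem_curvatureSteps hz
  have h1 : ‖gradient f x‖ / β ≤ r := by rwa [div_le_iff₀ hβ, mul_comm]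
  have h2 := norm_sub_le_norm_sub_add_norm_sub z x p
  have hr : 0 ≤ r := (norm_nonneg _).trans hx
  have h := norm_gradient_sub_sub_hessian_le hreg.contDiff hreg.M_pos.le hreg.hessian_lip
    (p := p) (x := x) (y := z) (R := 2 * r) (by linarith) (by linarith)
  rw [hzx] at h
  linarith

lemma IsRegular.jump_P (hreg : IsRegular f L M) (ha : IsAdmissible L M β b r σ c)
    (hs : IsSplitting (hessian f p) L b P Q)
    (hgap : ∀ lam, IsEigenvalue (hessian f p) lam → b ≤ |lam|)
    (hneg : ∃ lam < 0, IsEigenvalue (hessian f p) lam)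
    (hx : ‖x - p‖ ≤ r) (hg : ‖gradient f x‖ ≤ β * r) (hz : z ∈ curvatureSteps f L β x) :
    ‖P (gradient f z)‖ ≤
      ‖P (gradient f x)‖ + (L * σ + 2 * M * r) / β * ‖gradient f x‖ := by
  have h1 := hreg.norm_P_curvatureStep_le hs hgap hneg (ha.β_pos.trans ha.β_lt) ha.σ_pos.le
    ha.deviation ha.β_pos hx hz
  have h2 := (hs.norm_P_le_norm _).trans
    (hreg.norm_gradient_curvatureStep_sub_le ha.β_pos hx hg hz)
  rw [map_sub, map_sub] at h2
  have h3 := hs.norm_P_le (z - x)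
  have h4 : P (gradient f z) = P (gradient f x) + P (hessian f p (z - x)) +
      (P (gradient f z) - P (gradient f x) - P (hessian f p (z - x))) := by abel
  have h5 := norm_add₃_le (a := P (gradient f x)) (b := P (hessian f p (z - x)))
    (c := P (gradient f z) - P (gradient f x) - P (hessian f p (z - x)))
  rw [← h4] at h5
  have h6 : L * ‖P (z - x)‖ ≤ L * (σ * (‖gradient f x‖ / β)) :=
    mul_le_mul_of_nonneg_left h1 hreg.L_pos.le
  have h7 : (L * σ + 2 * M * r) / β * ‖gradient f x‖ =
      L * (σ * (‖gradient f x‖ / β)) + 2 * M * r * (‖gradient f x‖ / β) := by ring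
  linarith

/-- The new Q-part is at least b(1 - σ)‖∇f‖/β minus the old Q-part and the linearization error. As b
> β this keeps a positive multiple of ‖∇f‖, which beats c times the P-part when c is small. -/
lemma IsRegular.jump_Q (hreg : IsRegular f L M) (ha : IsAdmissible L M β b r σ c)
    (hs : IsSplitting (hessian f p) L b P Q)
    (hgap : ∀ lam, IsEigenvalue (hessian f p) lam → b ≤ |lam|)
    (hneg : ∃ lam < 0, IsEigenvalue (hessian f p) lam)
    (hx : ‖x - p‖ ≤ r) (hg : ‖gradient f x‖ ≤ β * r) (hg0 : gradient f x ≠ 0)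
    (hz : z ∈ curvatureSteps f L β x) :
    c * ‖P (gradient f z)‖ < ‖Q (gradient f z)‖ := by
  have hb : 0 < b := ha.β_pos.trans ha.β_lt
  have h1 := hreg.norm_P_curvatureStep_le hs hgap hneg hb ha.σ_pos.le
    ha.deviation ha.β_pos hx hz
  have h2 := (hs.norm_Q_le_norm _).trans
    (hreg.norm_gradient_curvatureStep_sub_le ha.β_pos hx hg hz)
  rw [map_sub, map_sub] at h2
  have h3 := hs.le_norm_Q (z - x)
  have h4 : Q (hessian f p (z - x)) = Q (gradient f z) + -Q (gradient f x) +
      -(Q (gradient f z) - Q (gradient f x) - Q (hessian f p (z - x))) := by abel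
  have h5 := norm_add₃_le (a := Q (gradient f z)) (b := -Q (gradient f x))
    (c := -(Q (gradient f z) - Q (gradient f x) - Q (hessian f p (z - x))))
  rw [← h4, norm_neg, norm_neg] at h5
  have h6 := hs.norm_Q_le_norm (gradient f x)
  have h7 := hs.norm_le_add (z - x)
  rw [norm_sub_eq_of_mem_curvatureSteps hz] at h7
  have h8 : b * (‖gradient f x‖ / β) ≤ b * (σ * (‖gradient f x‖ / β) + ‖Q (z - x)‖) := by
    gcongr
    linarith
  have h9 := hreg.jump_P ha hs hgap hneg hx hg hz
  have h10 := hs.norm_P_le_norm (gradient f x)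
  have hgpos : 0 < ‖gradient f x‖ := norm_pos_iff.2 hg0
  have hc := ha.c_pos
  calc c * ‖P (gradient f z)‖
      ≤ c * ((1 + (L * σ + 2 * M * r) / β) * ‖gradient f x‖) := by
        gcongr
        linarith
    _ = c * (1 + (L * σ + 2 * M * r) / β) * ‖gradient f x‖ := by ring
    _ < ((b - b * σ - 2 * M * r) / β - 1) * ‖gradient f x‖ :=
        mul_lt_mul_of_pos_right ha.jump_large hgpos
    _ = b * (‖gradient f x‖ / β) - b * (σ * (‖gradient f x‖ / β)) -
        2 * M * r * (‖gradient f x‖ / β) - ‖gradient f x‖ := by ring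
    _ ≤ ‖Q (gradient f z)‖ := by linarith

/-- Explains the threshold: 4/27 is the maximum of κ²(1 - κ) on [0, 1]. -/
lemma V₁_sub_V₂_le (hL : 0 < L) (hβ : 0 < β) (hβL : β ≤ L) (hε : 0 < ε)
    (hg : ‖gradient f x‖ ≤ L * ε)
    (h : inner ℝ (gradient f x) (gradient f (gradStep f L x)) ≤
      (1 - β / L) * ‖gradient f x‖ ^ 2) :
    V₁ f L x - V₂ f L x ≤ 4 * ε ^ 2 / (27 * (β / L) ^ 2) := by
  rw [V₁_sub_V₂]
  set κ := β / L with hκ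
  have hκ0 : 0 < κ := by positivity
  have hκ1 : κ ≤ 1 := (div_le_one hL).2 hβL
  have h1 : (1 - κ) * ‖gradient f x‖ ^ 2 ≤ (1 - κ) * (L * ε) ^ 2 := by
    have : 0 ≤ 1 - κ := by linarith
    gcongr
  have h2 : (1 / L) ^ 2 * inner ℝ (gradient f x) (gradient f (gradStep f L x)) ≤
      (1 / L) ^ 2 * ((1 - κ) * (L * ε) ^ 2) := by
    gcongr
    exact h.trans h1
  have h3 : (1 / L) ^ 2 * ((1 - κ) * (L * ε) ^ 2) = (1 - κ) * ε ^ 2 := by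
    field_simp
  refine (h2.trans h3.le).trans ?_
  rw [le_div_iff₀ (by positivity)]
  -- The factorization 27κ³ - 27κ² + 4 = (3κ - 2)²(3κ + 1).
  have h4 : 0 ≤ ε ^ 2 * ((3 * κ - 2) ^ 2 * (3 * κ + 1)) := by positivity
  nlinarith

lemma scaledHessian_isSymmetric (hf : ContDiff ℝ 2 f) (x : EuclideanSpace ℝ (Fin n)) :
    (scaledHessian f L x : EuclideanSpace ℝ (Fin n) →ₗ[ℝ] EuclideanSpace ℝ (Fin n)).IsSymmetric := by
  intro v w
  have h := hessian_isSymmetric hf x v w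
  simp only [ContinuousLinearMap.coe_coe] at h ⊢
  simp only [scaledHessian, smul_apply, inner_smul_left, inner_smul_right, h]
  simp

/-- In the stable cone of a strict saddle the curvature check succeeds. -/
lemma IsRegular.curvatureCheck_of_stable (hreg : IsRegular f L M)
    (ha : IsAdmissible L M β b r σ c) (hp : gradient f p = 0)
    (hs : IsSplitting (hessian f p) L b P Q)
    (hgap : ∀ lam, IsEigenvalue (hessian f p) lam → b ≤ |lam|)
    (hneg : ∃ lam < 0, IsEigenvalue (hessian f p) lam)
    (hε : 0 < ε) (hx : ‖x - p‖ ≤ r) (hg : ‖gradient f x‖ ≤ L * ε)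
    (hg' : gradient f (gradStep f L x) ≠ 0)
    (hcone : ‖Q (gradient f x)‖ ≤ c * ‖P (gradient f x)‖) : CurvatureCheck f L β ε Pmin x := by
  have hL := hreg.L_pos
  refine Or.inr ⟨V₁_sub_V₂_pos hL hreg.gradient_lip hg', ?_, ?_⟩
  · refine V₁_sub_V₂_le hL ha.β_pos (ha.β_lt.le.trans ha.b_le) hε hg ?_
    have h1 := hreg.inner_gradient_gradStep_le hp hx
    have h2 := hs.inner_le (gradient f x)
    have h3 : ‖Q (gradient f x)‖ ^ 2 ≤ (c * ‖P (gradient f x)‖) ^ 2 := by gcongr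
    have h4 := hs.norm_P_le_norm (gradient f x)
    have h5 : ‖P (gradient f x)‖ ^ 2 ≤ ‖gradient f x‖ ^ 2 := by gcongr
    have h6 : (c * ‖P (gradient f x)‖) ^ 2 ≤ c ^ 2 * ‖gradient f x‖ ^ 2 := by
      rw [mul_pow]
      gcongr
    have h7 : (1 - b / L) * ‖P (gradient f x)‖ ^ 2 ≤ (1 - b / L) * ‖gradient f x‖ ^ 2 := by
      have : b / L ≤ 1 := (div_le_one hL).2 ha.b_le
      have : 0 ≤ 1 - b / L := by linarith
      gcongr
    have h8 : (2 * c ^ 2 + 2 * M * r / L) * ‖gradient f x‖ ^ 2 ≤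
        (b - β) / L * ‖gradient f x‖ ^ 2 := by
      gcongr
      exact ha.stable
    rw [sub_div] at h8
    linarith
  · obtain ⟨m, hm0, hm⟩ := hneg
    obtain ⟨e, he, he2⟩ := hm.exists_eq_smul
    have hmb := hgap m hm
    rw [abs_of_neg hm0] at hmb
    refine exists_isEigenvalue_neg (scaledHessian_isSymmetric hreg.contDiff x) (v := e) ?_
    rw [inner_scaledHessian]
    have h1 := (abs_le.1 (hreg.abs_inner_hessian_sub_le hx e)).2
    rw [he2, inner_smul_right, real_inner_self_eq_norm_sq, he] at h1
    have h2 := ha.radius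
    have h3 := ha.β_pos
    have h4 : 0 < M * r := mul_pos hreg.M_pos ha.r_pos
    exact mul_neg_of_pos_of_neg (by positivity) (by linarith)

/-- Near a critical point which is not a strict saddle the curvature check fails. -/
lemma IsRegular.not_curvatureCheck (hreg : IsRegular f L M)
    (ha : IsAdmissible L M β b r σ c) (hp : gradient f p = 0)
    (hs : IsSplitting (hessian f p) L b P Q)
    (hnn : ∀ lam, IsEigenvalue (hessian f p) lam → 0 ≤ lam)
    (hε : 0 < ε) (hx : ‖x - p‖ ≤ r) (hg : ‖gradient f x‖ ≤ L * ε) :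
    ¬ CurvatureCheck f L β ε Pmin x := by
  have hL := hreg.L_pos
  have h1 := hreg.inner_gradient_gradStep_le hp hx
  have h2 := hs.le_inner_of_nonneg hnn (gradient f x)
  rw [inner_sub_right, inner_smul_right, real_inner_self_eq_norm_sq] at h1
  have h3 : 1 / L * (b * ‖gradient f x‖ ^ 2) ≤
      1 / L * inner ℝ (gradient f x) (hessian f p (gradient f x)) := by gcongr
  have h4 : (2 * c ^ 2 + 2 * M * r / L) * ‖gradient f x‖ ^ 2 ≤
      (b - β) / L * ‖gradient f x‖ ^ 2 := by
    gcongr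
    exact ha.stable
  have h5 : 0 ≤ 2 * c ^ 2 * ‖gradient f x‖ ^ 2 := by positivity
  have h6 := V₁_sub_V₂_le hL ha.β_pos (ha.β_lt.le.trans ha.b_le) hε hg (by
    have e1 : 1 / L * (b * ‖gradient f x‖ ^ 2) = b / L * ‖gradient f x‖ ^ 2 := by ring
    rw [e1] at h3
    rw [sub_div] at h4
    linarith)
  -- The first branch fails by the bound on `V₁ - V₂`; the second because ∇²f(x) is still positive
  -- definite.
  rintro (h | ⟨_, _, lam, hlam0, hlam⟩)
  · exact absurd h.1 (not_lt.2 h6)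
  · obtain ⟨e, he, he2⟩ := hlam.exists_eq_smul
    have h7 := inner_scaledHessian (f := f) (L := L) x e
    rw [he2, inner_smul_right, real_inner_self_eq_norm_sq, he] at h7
    have h8 := (abs_le.1 (hreg.abs_inner_hessian_sub_le hx e)).1
    have h9 := hs.le_inner_of_nonneg hnn e
    rw [he] at h8 h9
    have h10 := ha.radius
    have h11 : 0 < M * r := mul_pos hreg.M_pos ha.r_pos
    have h12 : 0 < 1 / L * inner ℝ e (hessian f x e) :=
      mul_pos (by positivity) (by linarith [ha.β_pos])
    linarith

end Local

end CCRGD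

/-! ### Escape from the neighbourhood of a strict saddle. -/

namespace CCRGD

variable {n : ℕ} {f : EuclideanSpace ℝ (Fin n) → ℝ} {L M β b r σ c ε Pmin : ℝ}

/-- The state `(x, Ξ)` asks for a second-order step. -/
def IsJump (f : EuclideanSpace ℝ (Fin n) → ℝ) (L β ε Pmin : ℝ) (x : EuclideanSpace ℝ (Fin n))
    (Ξ : Bool) : Prop :=
  ‖gradient f x‖ ≤ L * ε ∧ Ξ = false ∧ CurvatureCheck f L β ε Pmin x

namespace Step

variable {x x' : EuclideanSpace ℝ (Fin n)} {Ξ Ξ' : Bool}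

lemma eq_gradStep (h : Step f L β ε Pmin x Ξ x' Ξ') (hJ : ¬ IsJump f L β ε Pmin x Ξ) :
    x' = gradStep f L x := by
  cases h with
  | secondOrder _ hx hc hz => exact absurd ⟨hx, rfl, hc⟩ hJ
  | _ => rfl

lemma mem_curvatureSteps (h : Step f L β ε Pmin x Ξ x' Ξ') (hJ : IsJump f L β ε Pmin x Ξ) :
    x' ∈ curvatureSteps f L β x := by
  cases h with
  | largeGradient _ hx => exact absurd hJ.1 (not_le.2 hx)
  | flagged hx => exact absurd hJ.2.1 (by decide)
  | secondOrder _ hx hc hz => exact hz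
  | firstOrder hx hc => exact absurd hJ.2.2 hc

lemma flag_eq_true (h : Step f L β ε Pmin x Ξ x' Ξ') (hx : ‖gradient f x‖ ≤ L * ε) :
    Ξ' = true := by
  cases h with
  | largeGradient _ hx' => exact absurd hx (not_le.2 hx')
  | _ => rfl

lemma flag_eq_false (h : Step f L β ε Pmin x Ξ x' Ξ') (hx : L * ε < ‖gradient f x‖) :
    Ξ' = false := by
  cases h with
  | largeGradient _ _ => rfl
  | flagged hx' => exact absurd hx' (not_le.2 hx)
  | secondOrder _ hx' _ _ => exact absurd hx' (not_le.2 hx)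
  | firstOrder hx' _ => exact absurd hx' (not_le.2 hx)

end Step

/-- The iteration cannot stay forever in a small ball around a strict saddle. -/
theorem IsRegular.exists_not_mem_ball {p : EuclideanSpace ℝ (Fin n)}
    {P Q : EuclideanSpace ℝ (Fin n) →L[ℝ] EuclideanSpace ℝ (Fin n)}
    (hreg : IsRegular f L M) (ha : IsAdmissible L M β b r σ c) (hp : gradient f p = 0)
    (hs : IsSplitting (hessian f p) L b P Q)
    (hgap : ∀ lam, IsEigenvalue (hessian f p) lam → b ≤ |lam|)
    (hneg : ∃ lam < 0, IsEigenvalue (hessian f p) lam)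
    (hε : 0 < ε) (hεr : L * ε ≤ β * r)
    {x : ℕ → EuclideanSpace ℝ (Fin n)} {Ξ : ℕ → Bool}
    (hstep : ∀ k, Step f L β ε Pmin (x k) (Ξ k) (x (k + 1)) (Ξ (k + 1)))
    (hland : ∀ k, gradient f (x k) ≠ 0 → ¬ IsStrictSaddle f (gradStep f L (x k)))
    (h0 : Ξ 0 = false) (hx0 : gradient f (x 0) ≠ 0) :
    ∃ k, r < ‖x k - p‖ := by
  by_contra! hball
  have hL := hreg.L_pos
  have hβ := ha.β_pos
  have hb : 0 < b := hβ.trans ha.β_lt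
  have hM := hreg.M_pos
  have hr := ha.r_pos
  have hσ := ha.σ_pos
  have hg : ∀ k, IsJump f L β ε Pmin (x k) (Ξ k) → ‖gradient f (x k)‖ ≤ β * r :=
    fun k hk => hk.1.trans hεr
  -- No iterate becomes critical: a curvature step lands strictly inside the unstable cone, and p is
  -- the only critical point in the ball, which gradient steps may not hit.
  have hne : ∀ k, gradient f (x k) ≠ 0 := by
    intro k
    induction k with
    | zero => exact hx0
    | succ k ih =>
      by_cases hJ : IsJump f L β ε Pmin (x k) (Ξ k)
      · intro h
        have := hreg.jump_Q ha hs hgap hneg (hball k) (hg k hJ) ih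
          ((hstep k).mem_curvatureSteps hJ)
        simp [h] at this
      · intro h
        have h1 := hreg.mul_norm_sub_le hp hs ha.radius (x := x (k + 1))
          ((hball _).trans (by linarith))
        rw [h, norm_zero] at h1
        have h2 : ‖x (k + 1) - p‖ = 0 := by
          nlinarith [norm_nonneg (x (k + 1) - p)]
        have h3 : x (k + 1) = p := sub_eq_zero.1 (norm_eq_zero.1 h2)
        refine hland k ih ?_
        rw [← (hstep k).eq_gradStep hJ, h3]
        exact ⟨hp, hneg⟩
  have hη₂ : 2 * M * r / L ≤ (L * σ + 2 * M * r) / β := by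
    have h1 : 2 * M * r / L ≤ 2 * M * r / β := by
      gcongr
      exact ha.β_lt.le.trans ha.b_le
    have h2 : 2 * M * r / β ≤ (L * σ + 2 * M * r) / β := by
      gcongr
      have : 0 < L * σ := by positivity
      linarith
    exact h1.trans h2
  obtain ⟨K, hK, hKs, hK1, hK2⟩ := exists_last_entry (κ := b / L) (η := 2 * M * r / L)
    (η₂ := (L * σ + 2 * M * r) / β) (e := L * ε) (c := c) (B := L * r)
    (a := fun k => ‖P (gradient f (x k))‖) (b := fun k => ‖Q (gradient f (x k))‖)
    (G := fun k => ‖gradient f (x k)‖) (Ξ := Ξ) (J := fun k => IsJump f L β ε Pmin (x k) (Ξ k))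
    (by positivity) ((div_le_one hL).2 ha.b_le) (by positivity) hη₂ (by positivity) ha.jump_small
    (by positivity) ha.c_pos ha.cone_left ha.cone_right (fun _ => norm_nonneg _)
    (fun _ => norm_nonneg _) (fun k => hs.norm_le_add _) (fun k => hs.norm_Q_le_norm _)
    (fun k => (hs.norm_Q_le_norm _).trans ((hreg.norm_gradient_le hp _).trans (by
      have := hball k
      gcongr)))
    (fun k hk => by
      rw [(hstep k).eq_gradStep hk]
      exact hreg.contract hp hs (hball k))
    (fun k hk => by
      rw [(hstep k).eq_gradStep hk]
      exact hreg.expand hp hs (hball k))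
    (fun k hk => ⟨hk.1, hk.2.1, (hstep k).flag_eq_true hk.1,
      hreg.jump_P ha hs hgap hneg (hball k) (hg k hk) ((hstep k).mem_curvatureSteps hk)⟩)
    (fun k hk => (hstep k).flag_eq_true hk) (fun k hk => (hstep k).flag_eq_false hk) h0
  -- A jump at K would leave the stable cone; without a jump x_K is in that cone, where the check
  -- demands one.
  by_cases hJ : IsJump f L β ε Pmin (x K) (Ξ K)
  · exact absurd hK1 (not_le.2 (hreg.jump_Q ha hs hgap hneg (hball K) (hg K hJ) (hne K)
      ((hstep K).mem_curvatureSteps hJ)))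
  · refine hJ ⟨hKs K le_rfl, hK, hreg.curvatureCheck_of_stable ha hp hs hgap hneg hε (hball K)
      (hKs K le_rfl) ?_ (hK2 hJ)⟩
    rw [← (hstep K).eq_gradStep hJ]
    exact hne (K + 1)

end CCRGD

/-! ### Local minima, compactness and uniform constants from the Morse condition. -/

namespace CCRGD

variable {n : ℕ} {f : EuclideanSpace ℝ (Fin n) → ℝ} {L M β b r σ c ε Pmin : ℝ}

lemma gradient_eq_zero_of_isLocalMin {p : EuclideanSpace ℝ (Fin n)} (h : IsLocalMin f p) :
    gradient f p = 0 := by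
  rw [gradient, h.fderiv_eq_zero, map_zero]

lemma IsRegular.isLocalMin {p : EuclideanSpace ℝ (Fin n)}
    {P Q : EuclideanSpace ℝ (Fin n) →L[ℝ] EuclideanSpace ℝ (Fin n)}
    (hreg : IsRegular f L M) (hb : 0 < b) (hp : gradient f p = 0)
    (hs : IsSplitting (hessian f p) L b P Q)
    (hnn : ∀ lam, IsEigenvalue (hessian f p) lam → 0 ≤ lam) : IsLocalMin f p := by
  have hM := hreg.M_pos
  refine Metric.eventually_nhds_iff.2 ⟨b / M, by positivity, fun x hx => ?_⟩
  set v := x - p with hv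
  have hvn : ‖v‖ < b / M := by rwa [hv, ← dist_eq_norm]
  have hd : ∀ t : ℝ, HasDerivAt (fun t : ℝ => f (p + t • v))
      (inner ℝ (gradient f (p + t • v)) v) t := by
    intro t
    have h1 : HasDerivAt (fun t : ℝ => p + t • v) v t := by
      simpa using ((hasDerivAt_id t).smul_const v).const_add p
    have h2 : HasFDerivAt f (fderiv ℝ f (p + t • v)) (p + t • v) :=
      (hreg.contDiff.differentiable (by norm_num) _).hasFDerivAt
    have h3 := h2.comp_hasDerivAt t h1
    rwa [← inner_gradient_left] at h3
  have hmono : MonotoneOn (fun t : ℝ => f (p + t • v)) (Set.Icc 0 1) := by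
    refine monotoneOn_of_deriv_nonneg (convex_Icc 0 1)
      (fun t _ => (hd t).continuousAt.continuousWithinAt)
      (fun t _ => (hd t).differentiableAt.differentiableWithinAt) fun t ht => ?_
    rw [interior_Icc] at ht
    rw [(hd t).deriv]
    have htv : ‖t • v‖ ≤ ‖v‖ := by
      rw [norm_smul, Real.norm_of_nonneg ht.1.le]
      exact mul_le_of_le_one_left (norm_nonneg _) ht.2.le
    have h1 := norm_gradient_sub_sub_hessian_le hreg.contDiff hM.le hreg.hessian_lip
      (p := p) (x := p) (y := p + t • v) (R := ‖v‖) (by simp) (by simpa using htv)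
    rw [hp, sub_zero, add_sub_cancel_left] at h1
    have h2 := hs.le_inner_of_nonneg hnn (t • v)
    have h3 := (abs_le.1 ((abs_real_inner_le_norm (t • v)
      (gradient f (p + t • v) - hessian f p (t • v))))).1
    rw [inner_sub_right] at h3
    have h4 : ‖t • v‖ * ‖gradient f (p + t • v) - hessian f p (t • v)‖ ≤
        ‖t • v‖ * (M * ‖v‖ * ‖t • v‖) := by gcongr
    have h5 : M * ‖v‖ ≤ b := by
      rw [lt_div_iff₀ hM] at hvn
      linarith
    have h6 : M * ‖v‖ * ‖t • v‖ ^ 2 ≤ b * ‖t • v‖ ^ 2 := by gcongr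
    have h7 : 0 ≤ inner ℝ (t • v) (gradient f (p + t • v)) := by nlinarith
    rw [inner_smul_left, real_inner_comm] at h7
    exact nonneg_of_mul_nonneg_right h7 (by simpa using ht.1)
  have h := hmono (Set.left_mem_Icc.2 zero_le_one) (Set.right_mem_Icc.2 zero_le_one) zero_le_one
  simpa [hv] using h

lemma exists_forall_apply_le (hf : ContDiff ℝ 2 f)
    (hcoercive : Tendsto f (Bornology.cobounded (EuclideanSpace ℝ (Fin n))) atTop) :
    ∃ p, ∀ x, f p ≤ f x := by
  rw [Metric.cobounded_eq_cocompact] at hcoercive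
  exact hf.continuous.exists_forall_le hcoercive

lemma isCompact_sublevel (hf : ContDiff ℝ 2 f)
    (hcoercive : Tendsto f (Bornology.cobounded (EuclideanSpace ℝ (Fin n))) atTop) (y : ℝ) :
    IsCompact {x | f x ≤ y} := by
  refine Metric.isCompact_of_isClosed_isBounded (isClosed_le hf.continuous continuous_const) ?_
  have h := hcoercive.eventually (eventually_gt_atTop y)
  refine Bornology.isBounded_def.2 ?_
  filter_upwards [h] with x hx using not_le.2 hx

lemma lt_of_morse (hn : n ≠ 0) (hL : 0 < L) (hf : ContDiff ℝ 2 f)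
    (hcoercive : Tendsto f (Bornology.cobounded (EuclideanSpace ℝ (Fin n))) atTop)
    (hgrad : ∀ x y, ‖gradient f x - gradient f y‖ ≤ L * ‖x - y‖)
    (hmorse : ∀ x, gradient f x = 0 → ∀ lam : ℝ, IsEigenvalue (hessian f x) lam → β < |lam|) :
    β < L := by
  obtain ⟨p, hp⟩ := exists_forall_apply_le hf hcoercive
  obtain ⟨e, lam, hlam, -⟩ := exists_orthonormalBasis_inner_apply (hessian_isSymmetric hf p)
  have h := hlam ⟨0, Nat.pos_of_ne_zero hn⟩
  exact (hmorse p (gradient_eq_zero_of_isLocalMin (Eventually.of_forall hp)) _ h).trans_le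
    (h.abs_le (norm_hessian_le hL hgrad p))

/-- Critical points are isolated, since near each one the gradient is at least (β/2) times the
distance; an infinite compact set of them would accumulate. -/
lemma IsRegular.finite_critical (hreg : IsRegular f L M) (hβ : 0 < β) (hβL : β ≤ L)
    (hmorse : ∀ x, gradient f x = 0 → ∀ lam : ℝ, IsEigenvalue (hessian f x) lam → β < |lam|)
    {K : Set (EuclideanSpace ℝ (Fin n))} (hK : IsCompact K) :
    {p ∈ K | gradient f p = 0}.Finite := by
  have hM := hreg.M_pos
  have hcl : IsClosed {p | gradient f p = 0} :=
    isClosed_eq (contDiff_gradient hreg.contDiff).continuous continuous_const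
  have hcpt : IsCompact {p ∈ K | gradient f p = 0} := hK.inter_right hcl
  by_contra hinf
  obtain ⟨p, hp, hacc⟩ :=
    Set.Infinite.exists_accPt_of_subset_isCompact hinf hcpt subset_rfl
  obtain ⟨P, Q, hs⟩ := exists_isSplitting (hessian_isSymmetric hreg.contDiff p)
    (norm_hessian_le hreg.L_pos hreg.gradient_lip p) hβ hβL
    (fun lam hlam => (hmorse p hp.2 lam hlam).le)
  have hfr := accPt_iff_frequently.1 hacc
  have hball : ∀ᶠ y in 𝓝 p, ‖y - p‖ ≤ 2 * (β / (4 * M)) := by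
    filter_upwards [Metric.closedBall_mem_nhds p (by positivity : 0 < 2 * (β / (4 * M)))]
      with y hy using mem_closedBall_iff_norm.1 hy
  obtain ⟨y, ⟨hyp, hy⟩, hy2⟩ := (hfr.and_eventually hball).exists
  have h := hreg.mul_norm_sub_le (β := β / 2) hp.2 hs (by
    have : 2 * M * (β / (4 * M)) = β / 2 := by field_simp; norm_num
    linarith) hy2
  rw [hy.2, norm_zero] at h
  have h2 : 0 < ‖y - p‖ := norm_pos_iff.2 (sub_ne_zero.2 hyp)
  have : 0 < β / 2 * ‖y - p‖ := by positivity
  linarith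

/-- Finiteness turns the strict bound |λ| > β into a uniform gap b > β; this margin is what makes
curvature steps overshoot. -/
lemma IsRegular.exists_gap (hreg : IsRegular f L M) (hβ : 0 < β) (hβL : β < L)
    (hmorse : ∀ x, gradient f x = 0 → ∀ lam : ℝ, IsEigenvalue (hessian f x) lam → β < |lam|)
    {K : Set (EuclideanSpace ℝ (Fin n))} (hK : IsCompact K) :
    ∃ b, β < b ∧ b ≤ L ∧ ∀ p ∈ K, gradient f p = 0 →
      ∀ lam, IsEigenvalue (hessian f p) lam → b ≤ |lam| := by
  have hfin : (⋃ p ∈ {p ∈ K | gradient f p = 0}, {lam | IsEigenvalue (hessian f p) lam}).Finite :=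
    (hreg.finite_critical hβ hβL.le hmorse hK).biUnion fun p _ =>
      Module.End.finite_hasEigenvalue (hessian f p : Module.End ℝ (EuclideanSpace ℝ (Fin n)))
  -- Inserting L makes the set nonempty and ensures b ≤ L.
  obtain ⟨m, hm, hmin⟩ := Set.exists_min_image _ (fun lam : ℝ => |lam|)
    (hfin.insert L) ⟨L, Set.mem_insert _ _⟩
  refine ⟨|m|, ?_, ?_, fun p hpK hp lam hlam => ?_⟩
  · rcases hm with rfl | hm
    · rwa [abs_of_pos hreg.L_pos]
    · simp only [Set.mem_iUnion] at hm
      obtain ⟨p, hp, hm⟩ := hm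
      exact hmorse p hp.2 m hm
  · exact (hmin L (Set.mem_insert _ _)).trans (abs_of_pos hreg.L_pos).le
  · exact hmin lam (Set.mem_insert_of_mem _ (Set.mem_biUnion (show p ∈ _ from ⟨hpK, hp⟩) hlam))

lemma exists_near_critical (hf : ContDiff ℝ 2 f) {K : Set (EuclideanSpace ℝ (Fin n))}
    (hK : IsCompact K) {r : ℝ} (hr : 0 < r) :
    ∃ g₀ > 0, ∀ x ∈ K, ‖gradient f x‖ < g₀ → ∃ p, gradient f p = 0 ∧ ‖x - p‖ < r := by
  have hcont : Continuous fun x => ‖gradient f x‖ := (contDiff_gradient hf).continuous.norm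
  have hcl : IsClosed {x | ∀ p, gradient f p = 0 → r ≤ ‖x - p‖} := by
    simp only [Set.ofPred_forall]
    exact isClosed_iInter fun p => isClosed_iInter fun _ =>
      isClosed_le continuous_const (by fun_prop)
  rcases (K ∩ {x | ∀ p, gradient f p = 0 → r ≤ ‖x - p‖}).eq_empty_or_nonempty with he | hne
  · refine ⟨1, one_pos, fun x hx _ => ?_⟩
    by_contra! h
    exact Set.eq_empty_iff_forall_notMem.1 he x ⟨hx, h⟩
  · obtain ⟨y, hy, hmin⟩ := (hK.inter_right hcl).exists_isMinOn hne hcont.continuousOn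
    refine ⟨‖gradient f y‖, norm_pos_iff.2 fun h0 => ?_, fun x hx hxg => ?_⟩
    · have := hy.2 y h0
      simp at this
      linarith
    · by_contra! h
      exact absurd (hmin (show x ∈ _ from ⟨hx, h⟩)) (not_le.2 hxg)

/-- Constants which are uniform over the sublevel set of `x₀`. -/
lemma IsRegular.exists_uniform_constants (hreg : IsRegular f L M) (hβ : 0 < β) (hβL : β < L)
    (hcoercive : Tendsto f (Bornology.cobounded (EuclideanSpace ℝ (Fin n))) atTop)
    (hmorse : ∀ x, gradient f x = 0 → ∀ lam : ℝ, IsEigenvalue (hessian f x) lam → β < |lam|)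
    (y : ℝ) :
    ∃ b r σ c g₀, IsAdmissible L M β b r σ c ∧ 0 < g₀ ∧
      ∀ x, f x ≤ y → ‖gradient f x‖ < g₀ → ∃ p, gradient f p = 0 ∧ ‖x - p‖ ≤ r ∧
        ∀ lam, IsEigenvalue (hessian f p) lam → b ≤ |lam| := by
  have hK := isCompact_sublevel hreg.contDiff hcoercive y
  -- The thickening is needed because the critical point near x may lie outside the sublevel set.
  obtain ⟨b, hb, hbL, hgap⟩ := hreg.exists_gap hβ hβL hmorse (hK.cthickening (r := 1))
  obtain ⟨r, σ, c, ha⟩ := exists_isAdmissible hreg.L_pos hreg.M_pos hβ hb hbL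
  obtain ⟨g₀, hg₀, hnear⟩ := exists_near_critical hreg.contDiff hK
    (lt_min ha.r_pos one_pos : 0 < min r 1)
  refine ⟨b, r, σ, c, g₀, ha, hg₀, fun x hx hxg => ?_⟩
  obtain ⟨p, hp, hxp⟩ := hnear x hx hxg
  refine ⟨p, hp, hxp.le.trans (min_le_left _ _), hgap p ?_ hp⟩
  refine Metric.mem_cthickening_of_dist_le p x 1 _ hx ?_
  rw [dist_comm, dist_eq_norm]
  exact hxp.le.trans (min_le_right _ _)

end CCRGD

/-! ### Energy decrease, termination of curvature steps, and convergence. -/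

namespace CCRGD

variable {n : ℕ} {f : EuclideanSpace ℝ (Fin n) → ℝ} {L M β b r σ c g₀ ε Pmin y : ℝ}

lemma IsRegular.apply_gradStep_le_apply (hreg : IsRegular f L M) (x : EuclideanSpace ℝ (Fin n)) :
    f (gradStep f L x) ≤ f x := by
  have h := apply_gradStep_le hreg.L_pos hreg.contDiff hreg.gradient_lip x
  have hL := hreg.L_pos
  have : 0 ≤ 1 / (2 * L) * ‖gradient f x‖ ^ 2 := by positivity
  linarith

lemma not_isStrictSaddle_gradStep {x : EuclideanSpace ℝ (Fin n)} (hx : ¬ IsStrictSaddle f x)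
    (hland : gradient f x ≠ 0 → ¬ IsStrictSaddle f (gradStep f L x)) :
    ¬ IsStrictSaddle f (gradStep f L x) := by
  by_cases h : gradient f x = 0
  · rwa [gradStep_of_gradient_eq_zero h]
  · exact hland h

/-- After a second-order step near a strict saddle the iteration leaves the neighbourhood of the
saddle, at a point where `f` has dropped by a fixed amount. -/
lemma IsRegular.exists_exit {p : EuclideanSpace ℝ (Fin n)}
    {P Q : EuclideanSpace ℝ (Fin n) →L[ℝ] EuclideanSpace ℝ (Fin n)}
    (hreg : IsRegular f L M) (ha : IsAdmissible L M β b r σ c) (hp : gradient f p = 0)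
    (hs : IsSplitting (hessian f p) L b P Q)
    (hgap : ∀ lam, IsEigenvalue (hessian f p) lam → b ≤ |lam|)
    (hneg : ∃ lam < 0, IsEigenvalue (hessian f p) lam)
    (hε : 0 < ε) (hεr : L * ε / β ≤ β * r / (8 * L))
    {x : ℕ → EuclideanSpace ℝ (Fin n)} {Ξ : ℕ → Bool}
    (hstep : ∀ k, Step f L β ε Pmin (x k) (Ξ k) (x (k + 1)) (Ξ (k + 1)))
    (hland : ∀ k, gradient f (x k) ≠ 0 → ¬ IsStrictSaddle f (gradStep f L (x k)))
    (h0 : IsJump f L β ε Pmin (x 0) (Ξ 0)) (hx0 : ‖x 0 - p‖ ≤ r) :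
    ∃ k, f (x k) ≤ f (x 0) - β ^ 2 * r ^ 2 / (16 * L) ∧ L * ε < ‖gradient f (x k)‖ ∧
      ¬ IsJump f L β ε Pmin (x k) (Ξ k) := by
  have hL := hreg.L_pos
  have hβ := ha.β_pos
  have hr := ha.r_pos
  have hβL : β ≤ L := ha.β_lt.le.trans ha.b_le
  set d := L * ε / β with hd
  have hd0 : 0 < d := by positivity
  have hdr : d ≤ r / 8 := by
    refine hεr.trans ?_
    rw [div_le_div_iff₀ (by positivity) (by norm_num)]
    nlinarith
  have hLε : L * ε = β * d := by rw [hd]; field_simp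
  have hLεr : L * ε < β * r := by rw [hLε]; gcongr; linarith
  have hnear : ∀ k, ‖x k - p‖ ≤ r → ‖gradient f (x k)‖ ≤ L * ε → ‖x k - p‖ ≤ d := by
    intro k hk hk2
    have := hreg.mul_norm_sub_le hp hs ha.radius (hk.trans (by linarith))
    rw [hLε] at hk2
    exact le_of_mul_le_mul_left (this.trans hk2) hβ
  have hjump : ∀ k, ‖x k - p‖ ≤ r → IsJump f L β ε Pmin (x k) (Ξ k) →
      ‖x (k + 1) - p‖ ≤ 2 * d := by
    intro k hk hJ
    have h1 := norm_sub_eq_of_mem_curvatureSteps ((hstep k).mem_curvatureSteps hJ)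
    have h2 := norm_sub_le_norm_sub_add_norm_sub (x (k + 1)) (x k) p
    have h3 : ‖gradient f (x k)‖ / β ≤ d := by
      rw [hd]
      gcongr
      exact hJ.1
    linarith [hnear k hk hJ.1]
  have hexit := hreg.exists_not_mem_ball ha hp hs hgap hneg hε hLεr.le hstep hland h0.2.1
    h0.2.2.gradient_ne_zero
  classical
  obtain ⟨hk1, hmin⟩ := And.intro (Nat.find_spec hexit) (fun j => Nat.find_min hexit (m := j))
  set k := Nat.find hexit
  have hmin : ∀ j < k, ‖x j - p‖ ≤ r := fun j hj => not_lt.1 (hmin j hj)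
  have hfp : ∀ z, ‖z - p‖ ≤ 2 * d → |f z - f p| ≤ 2 * L * d ^ 2 := by
    intro z hz
    have h1 : ‖z - p‖ ^ 2 ≤ (2 * d) ^ 2 := by gcongr
    have h2 := abs_sub_le_of_gradient_eq_zero hreg.contDiff hreg.gradient_lip hp z
    have h3 : L / 2 * ‖z - p‖ ^ 2 ≤ L / 2 * (2 * d) ^ 2 := by gcongr
    linarith
  have hf0 := abs_le.1 (hfp (x 0) ((hnear 0 hx0 h0.1).trans (by linarith)))
  -- Curvature steps land within 2d of p, so their values are compared with f(p) directly and
  -- increases do not accumulate.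
  have hval : ∀ j < k, f (x j) ≤ f p + 2 * L * d ^ 2 := by
    intro j
    induction j with
    | zero => exact fun _ => by linarith [hf0.2]
    | succ j ih =>
      intro hj
      by_cases hJ : IsJump f L β ε Pmin (x j) (Ξ j)
      · have := (abs_le.1 (hfp _ (hjump j (hmin j (by omega)) hJ))).2
        linarith
      · rw [(hstep j).eq_gradStep hJ]
        exact (hreg.apply_gradStep_le_apply _).trans (ih (by omega))
  have hk0 : k ≠ 0 := by
    intro h
    rw [h] at hk1
    linarith
  obtain ⟨j, hj⟩ := Nat.exists_eq_succ_of_ne_zero hk0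
  have hjk : j < k := by omega
  rw [Nat.succ_eq_add_one] at hj
  rw [hj] at hk1
  -- The exit is made by a gradient step, as curvature steps land within 2d < r. Such a step at most
  -- doubles the distance, so it starts at distance at least r/2, where the gradient is at least
  -- βr/2.
  have hJ : ¬ IsJump f L β ε Pmin (x j) (Ξ j) := by
    intro hJ
    linarith [hjump j (hmin j hjk) hJ]
  have hgs := (hstep j).eq_gradStep hJ
  have h1 := hreg.norm_gradStep_sub_le hp (x j)
  have h2 := apply_gradStep_le hL hreg.contDiff hreg.gradient_lip (x j)
  rw [← hgs] at h1 h2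
  have h3 := hreg.mul_norm_sub_le hp hs ha.radius (x := x j)
    ((hmin j hjk).trans (by linarith))
  have h4 := hreg.mul_norm_sub_le hp hs ha.radius (x := x (j + 1))
    (h1.trans (by linarith [hmin j hjk]))
  have h5 : L * ε < ‖gradient f (x (j + 1))‖ := by
    have : β * r ≤ β * ‖x (j + 1) - p‖ := by gcongr
    linarith
  refine ⟨j + 1, ?_, h5, fun h => absurd h.1 (not_le.2 h5)⟩
  have h6 : β * (r / 2) ≤ ‖gradient f (x j)‖ := by
    have : β * (r / 2) ≤ β * ‖x j - p‖ := by
      gcongr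
      linarith
    linarith
  have h7 : 1 / (2 * L) * (β * (r / 2)) ^ 2 ≤ 1 / (2 * L) * ‖gradient f (x j)‖ ^ 2 := by
    gcongr
  have h8 : 4 * L * d ^ 2 ≤ 4 * L * (β * r / (8 * L)) ^ 2 := by gcongr
  have e1 : 1 / (2 * L) * (β * (r / 2)) ^ 2 = 2 * (β ^ 2 * r ^ 2 / (16 * L)) := by
    field_simp
    norm_num
  have e2 : 4 * L * (β * r / (8 * L)) ^ 2 = β ^ 2 * r ^ 2 / (16 * L) := by
    field_simp
    norm_num
  linarith [hval j hjk, hf0.1]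

/-- The constants are uniform over the critical points near the sublevel set of height `y`. -/
def HasUniformConstants (f : EuclideanSpace ℝ (Fin n) → ℝ) (b r g₀ y : ℝ) : Prop :=
  ∀ x, f x ≤ y → ‖gradient f x‖ < g₀ → ∃ p, gradient f p = 0 ∧ ‖x - p‖ ≤ r ∧
    ∀ lam, IsEigenvalue (hessian f p) lam → b ≤ |lam|

lemma IsRegular.exists_splitting (hreg : IsRegular f L M) (ha : IsAdmissible L M β b r σ c)
    {p : EuclideanSpace ℝ (Fin n)} (hgap : ∀ lam, IsEigenvalue (hessian f p) lam → b ≤ |lam|) :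
    ∃ P Q, IsSplitting (hessian f p) L b P Q :=
  exists_isSplitting (hessian_isSymmetric hreg.contDiff p)
    (norm_hessian_le hreg.L_pos hreg.gradient_lip p) (ha.β_pos.trans ha.β_lt) ha.b_le hgap

/-- From a suitable state either only gradient steps are taken, or `f` drops by a fixed amount. -/
lemma IsRegular.exists_drop (hreg : IsRegular f L M) (ha : IsAdmissible L M β b r σ c)
    (hunif : HasUniformConstants f b r g₀ y)
    (hε : 0 < ε) (hεr : L * ε / β ≤ β * r / (8 * L)) (hεg : L * ε < g₀)
    {x : ℕ → EuclideanSpace ℝ (Fin n)} {Ξ : ℕ → Bool}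
    (hstep : ∀ k, Step f L β ε Pmin (x k) (Ξ k) (x (k + 1)) (Ξ (k + 1)))
    (hland : ∀ k, gradient f (x k) ≠ 0 → ¬ IsStrictSaddle f (gradStep f L (x k)))
    (hy : f (x 0) ≤ y) :
    (∀ k, ¬ IsJump f L β ε Pmin (x k) (Ξ k)) ∨
      ∃ k, f (x k) ≤ f (x 0) - β ^ 2 * r ^ 2 / (16 * L) ∧ Ξ k = false ∧
        ¬ IsStrictSaddle f (x k) := by
  by_cases hall : ∃ k, IsJump f L β ε Pmin (x k) (Ξ k)
  swap
  · exact Or.inl (not_exists.1 hall)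
  classical
  right
  obtain ⟨hk1, hmin⟩ := And.intro (Nat.find_spec hall) (fun j => Nat.find_min hall (m := j))
  set k := Nat.find hall
  have hmono : ∀ j ≤ k, f (x j) ≤ f (x 0) := by
    intro j
    induction j with
    | zero => exact fun _ => le_rfl
    | succ j ih =>
      intro hj
      rw [(hstep j).eq_gradStep (hmin j (by omega))]
      exact (hreg.apply_gradStep_le_apply _).trans (ih (by omega))
  obtain ⟨p, hp, hxp, hgap⟩ := hunif (x k) ((hmono k le_rfl).trans hy) (hk1.1.trans_lt hεg)
  obtain ⟨P, Q, hs⟩ := hreg.exists_splitting ha hgap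
  have hneg : ∃ lam < 0, IsEigenvalue (hessian f p) lam := by
    by_contra! h
    exact hreg.not_curvatureCheck ha hp hs (fun lam hlam => not_lt.1 fun hl => h lam hl hlam) hε
      hxp hk1.1 hk1.2.2
  obtain ⟨j, hj1, hj2, hj3⟩ := hreg.exists_exit ha hp hs hgap hneg hε hεr
    (x := fun j => x (k + j)) (Ξ := fun j => Ξ (k + j)) (fun j => hstep (k + j))
    (fun j => hland (k + j)) hk1 hxp
  have hgs := (hstep (k + j)).eq_gradStep hj3
  -- One step past the exit: the large gradient at the exit turns the flag off for the next state,
  -- and that noncritical gradient step avoids strict saddles.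
  refine ⟨k + j + 1, ?_, (hstep (k + j)).flag_eq_false hj2, ?_⟩
  · rw [hgs]
    have h1 := hreg.apply_gradStep_le_apply (x (k + j))
    have h2 := hmono k le_rfl
    simp only [Nat.add_zero] at hj1
    linarith
  · rw [hgs]
    refine hland _ fun h => ?_
    rw [h, norm_zero] at hj2
    have : 0 < L * ε := mul_pos hreg.L_pos hε
    linarith

lemma IsRegular.exists_forall_not_isJump (hreg : IsRegular f L M)
    (hcoercive : Tendsto f (Bornology.cobounded (EuclideanSpace ℝ (Fin n))) atTop)
    (ha : IsAdmissible L M β b r σ c) (hunif : HasUniformConstants f b r g₀ y)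
    (hε : 0 < ε) (hεr : L * ε / β ≤ β * r / (8 * L)) (hεg : L * ε < g₀)
    {x : ℕ → EuclideanSpace ℝ (Fin n)} {Ξ : ℕ → Bool}
    (hstep : ∀ k, Step f L β ε Pmin (x k) (Ξ k) (x (k + 1)) (Ξ (k + 1)))
    (hland : ∀ k, gradient f (x k) ≠ 0 → ¬ IsStrictSaddle f (gradStep f L (x k)))
    (hy : f (x 0) ≤ y) (h0 : Ξ 0 = false) (hx0 : ¬ IsStrictSaddle f (x 0)) :
    ∃ T, f (x T) ≤ y ∧ Ξ T = false ∧ ¬ IsStrictSaddle f (x T) ∧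
      ∀ k, ¬ IsJump f L β ε Pmin (x (T + k)) (Ξ (T + k)) := by
  by_contra! hcon
  have hδ : 0 < β ^ 2 * r ^ 2 / (16 * L) := by
    have := hreg.L_pos
    have := ha.β_pos
    have := ha.r_pos
    positivity
  set δ := β ^ 2 * r ^ 2 / (16 * L)
  have key : ∀ N : ℕ, ∃ T, f (x T) ≤ y - N * δ ∧ Ξ T = false ∧ ¬ IsStrictSaddle f (x T) := by
    intro N
    induction N with
    | zero => exact ⟨0, by simpa using hy, h0, hx0⟩
    | succ N ih =>
      obtain ⟨T, hT1, hT2, hT3⟩ := ih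
      have hTy : f (x T) ≤ y := hT1.trans (by
        have : 0 ≤ (N : ℝ) * δ := by positivity
        linarith)
      rcases hreg.exists_drop ha hunif hε hεr hεg (x := fun k => x (T + k))
        (Ξ := fun k => Ξ (T + k)) (fun k => hstep (T + k)) (fun k => hland (T + k)) hTy with h | h
      · obtain ⟨k, hk⟩ := hcon T hTy hT2 hT3
        exact absurd hk (h k)
      · obtain ⟨k, hk1, hk2, hk3⟩ := h
        refine ⟨T + k, ?_, hk2, hk3⟩
        simp only [Nat.add_zero] at hk1
        push_cast
        linarith
  obtain ⟨q, hq⟩ := exists_forall_apply_le hreg.contDiff hcoercive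
  obtain ⟨N, hN⟩ := exists_nat_gt ((y - f q) / δ)
  rw [div_lt_iff₀ hδ] at hN
  obtain ⟨T, hT, -⟩ := key N
  linarith [hq (x T)]

lemma IsRegular.tendsto_gradient (hreg : IsRegular f L M)
    (hcoercive : Tendsto f (Bornology.cobounded (EuclideanSpace ℝ (Fin n))) atTop)
    {x : ℕ → EuclideanSpace ℝ (Fin n)} (hx : ∀ k, x (k + 1) = gradStep f L (x k)) :
    Tendsto (fun k => ‖gradient f (x k)‖) atTop (𝓝 0) := by
  have hL := hreg.L_pos
  have hdec : ∀ k, 1 / (2 * L) * ‖gradient f (x k)‖ ^ 2 ≤ f (x k) - f (x (k + 1)) := by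
    intro k
    rw [hx]
    linarith [apply_gradStep_le hL hreg.contDiff hreg.gradient_lip (x k)]
  have hanti : Antitone fun k => f (x k) := antitone_nat_of_succ_le fun k => by
    rw [hx]
    exact hreg.apply_gradStep_le_apply _
  obtain ⟨q, hq⟩ := exists_forall_apply_le hreg.contDiff hcoercive
  have hlim := tendsto_atTop_ciInf hanti ⟨f q, by rintro _ ⟨k, rfl⟩; exact hq _⟩
  have hdiff := hlim.sub (hlim.comp (tendsto_add_atTop_nat 1))
  rw [sub_self] at hdiff
  have h1 : Tendsto (fun k => ‖gradient f (x k)‖ ^ 2) atTop (𝓝 0) := by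
    refine squeeze_zero (fun k => by positivity) (fun k => ?_)
      (by simpa using hdiff.const_mul (2 * L))
    have h2 : 2 * L * (1 / (2 * L) * ‖gradient f (x k)‖ ^ 2) ≤
        2 * L * (f (x k) - f (x (k + 1))) := by
      gcongr
      exact hdec k
    refine le_trans (le_of_eq ?_) h2
    field_simp
  simpa [Real.sqrt_sq] using h1.sqrt

/-- A run consisting of gradient steps only converges to a local minimum. -/
lemma IsRegular.exists_tendsto_isLocalMin (hreg : IsRegular f L M)
    (hcoercive : Tendsto f (Bornology.cobounded (EuclideanSpace ℝ (Fin n))) atTop)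
    (ha : IsAdmissible L M β b r σ c) (hunif : HasUniformConstants f b r g₀ y)
    (hε : 0 < ε) (hεr : L * ε / β ≤ β * r / (8 * L)) (hεg : L * ε < g₀)
    {x : ℕ → EuclideanSpace ℝ (Fin n)} {Ξ : ℕ → Bool}
    (hstep : ∀ k, Step f L β ε Pmin (x k) (Ξ k) (x (k + 1)) (Ξ (k + 1)))
    (hland : ∀ k, gradient f (x k) ≠ 0 → ¬ IsStrictSaddle f (gradStep f L (x k)))
    (hy : f (x 0) ≤ y) (h0 : Ξ 0 = false) (hx0 : ¬ IsStrictSaddle f (x 0))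
    (hJ : ∀ k, ¬ IsJump f L β ε Pmin (x k) (Ξ k)) :
    ∃ p, IsLocalMin f p ∧ Tendsto x atTop (𝓝 p) := by
  have hL := hreg.L_pos
  have hβ := ha.β_pos
  have hr := ha.r_pos
  have hβL : β ≤ L := ha.β_lt.le.trans ha.b_le
  have hgs : ∀ k, x (k + 1) = gradStep f L (x k) := fun k => (hstep k).eq_gradStep (hJ k)
  have hg := hreg.tendsto_gradient hcoercive hgs
  have hfy : ∀ k, f (x k) ≤ y := by
    intro k
    induction k with
    | zero => exact hy
    | succ k ih =>
      rw [hgs]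
      exact (hreg.apply_gradStep_le_apply _).trans ih
  have hns : ∀ k, ¬ IsStrictSaddle f (x k) := by
    intro k
    induction k with
    | zero => exact hx0
    | succ k ih =>
      rw [hgs]
      exact not_isStrictSaddle_gradStep ih (hland k)
  obtain ⟨K, hK, hKs⟩ := exists_last_unflagged (e := L * ε) (G := fun k => ‖gradient f (x k)‖) h0
    (fun k hk => (hstep k).flag_eq_false hk)
    (eventually_atTop.1 ((hg.eventually (gt_mem_nhds (mul_pos hL hε))).mono fun _ h => h.le))
  obtain ⟨p, hp, hxp, hgap⟩ := hunif (x K) (hfy K) ((hKs K le_rfl).trans_lt hεg)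
  obtain ⟨P, Q, hs⟩ := hreg.exists_splitting ha hgap
  have hdr : 2 * (L * ε) ≤ β * r := by
    rw [div_le_div_iff₀ hβ (by positivity)] at hεr
    have h1 : β * r * β ≤ β * r * L := by gcongr
    have h2 : 8 * (L * ε) * L ≤ β * r * L := by linarith
    have h3 := le_of_mul_le_mul_right h2 hL
    have : 0 < L * ε := by positivity
    linarith
  -- Small gradients keep the run within Lε/β of p, and one step at most doubles that, so it cannot
  -- cross to another critical point.
  have hball : ∀ j, ‖x (K + j) - p‖ ≤ r := by
    intro j
    induction j with
    | zero => exact hxp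
    | succ j ih =>
      have h1 := hreg.mul_norm_sub_le hp hs ha.radius (ih.trans (by linarith))
      have h2 := hKs (K + j) (by omega)
      have h3 : β * (2 * ‖x (K + j) - p‖) ≤ β * r := by linarith
      rw [← add_assoc, hgs]
      exact (hreg.norm_gradStep_sub_le hp _).trans (le_of_mul_le_mul_left h3 hβ)
  have hlim : Tendsto x atTop (𝓝 p) := by
    rw [tendsto_iff_norm_sub_tendsto_zero]
    refine squeeze_zero' (Eventually.of_forall fun _ => norm_nonneg _) ?_
      (by simpa using hg.div_const β)
    filter_upwards [eventually_ge_atTop K] with k hk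
    have h1 := hball (k - K)
    rw [Nat.add_sub_cancel' hk] at h1
    rw [le_div_iff₀ hβ, mul_comm]
    exact hreg.mul_norm_sub_le hp hs ha.radius (h1.trans (by linarith))
  refine ⟨p, hreg.isLocalMin (hβ.trans ha.β_lt) hp hs fun lam hlam => ?_, hlim⟩
  by_contra! hneg
  -- The escape theorem needs a noncritical start; from a critical start the run is constant, so x_K
  -- = p would itself be a strict saddle.
  by_cases hgK : gradient f (x K) = 0
  · have hconst : ∀ j, x (K + j) = x K := by
      intro j
      induction j with
      | zero => rfl
      | succ j ih => rw [← add_assoc, hgs, ih, gradStep_of_gradient_eq_zero hgK]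
    have h1 : Tendsto x atTop (𝓝 (x K)) := by
      refine tendsto_const_nhds.congr' ?_
      filter_upwards [eventually_ge_atTop K] with k hk
      rw [← hconst (k - K), Nat.add_sub_cancel' hk]
    refine hns K ?_
    rw [tendsto_nhds_unique h1 hlim]
    exact ⟨hp, lam, hneg, hlam⟩
  · obtain ⟨k, hk⟩ := hreg.exists_not_mem_ball ha hp hs hgap ⟨lam, hneg, hlam⟩ hε
      (by have : 0 < L * ε := by positivity
          linarith)
      (x := fun j => x (K + j)) (Ξ := fun j => Ξ (K + j)) (fun j => hstep (K + j))
      (fun j => hland (K + j)) hK hgK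
    exact absurd (hball k) (not_le.2 hk)

lemma exists_isLocalMin_tendsto_of_isIterateSequence (hL : 0 < L) (hβ : 0 < β)
    (hf : ContDiff ℝ 2 f)
    (hcoercive : Tendsto f (Bornology.cobounded (EuclideanSpace ℝ (Fin n))) atTop)
    (hgrad : ∀ x y, ‖gradient f x - gradient f y‖ ≤ L * ‖x - y‖)
    (hhess : ∀ x y, ‖hessian f x - hessian f y‖ ≤ M * ‖x - y‖)
    (hmorse : ∀ x, gradient f x = 0 → ∀ lam : ℝ, IsEigenvalue (hessian f x) lam → β < |lam|)
    {x₀ : EuclideanSpace ℝ (Fin n)} (hx₀ : ¬ IsStrictSaddle f x₀) :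
    ∃ ε₀ : ℝ, 0 < ε₀ ∧ ∀ ε : ℝ, 0 < ε → ε < ε₀ → ∀ Pmin : ℝ,
      ∀ x : ℕ → EuclideanSpace ℝ (Fin n), IsIterateSequence f L β ε Pmin x₀ x →
        (∀ k, gradient f (x k) ≠ 0 → ¬ IsStrictSaddle f (gradStep f L (x k))) →
        ∃ p, IsLocalMin f p ∧ Tendsto x atTop (𝓝 p) := by
  -- In dimension 0 there are no eigenvalues, so β < L may fail; the claim is trivial there.
  rcases eq_or_ne n 0 with rfl | hn
  · refine ⟨1, one_pos, fun ε _ _ Pmin x _ _ => ⟨x₀, ?_, ?_⟩⟩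
    · exact Eventually.of_forall fun y => (congrArg f (Subsingleton.elim x₀ y)).le
    · exact tendsto_const_nhds.congr fun k => Subsingleton.elim _ _
  have hreg : IsRegular f L (max M 1) := ⟨hL, lt_max_of_lt_right one_pos, hf, hgrad, fun x y =>
    (hhess x y).trans (by gcongr; exact le_max_left _ _)⟩
  have hβL := lt_of_morse hn hL hf hcoercive hgrad hmorse
  obtain ⟨b, r, σ, c, g₀, ha, hg₀, hunif⟩ :=
    hreg.exists_uniform_constants hβ hβL hcoercive hmorse (f x₀)
  have hr := ha.r_pos
  -- The first bound makes the drop at an exit outweigh the rise from curvature steps; the second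
  -- keeps small-gradient iterates near critical points.
  refine ⟨min (β ^ 2 * r / (8 * L ^ 2)) (g₀ / L), by positivity, ?_⟩
  rintro ε hε hεlt Pmin x ⟨hx0, Ξ, hΞ0, hstep⟩ hland
  obtain ⟨hε1, hε2⟩ := lt_min_iff.1 hεlt
  have hεr : L * ε / β ≤ β * r / (8 * L) := by
    rw [div_le_div_iff₀ hβ (by positivity)]
    rw [lt_div_iff₀ (by positivity)] at hε1
    nlinarith
  have hεg : L * ε < g₀ := by
    rw [lt_div_iff₀ hL] at hε2
    linarith
  obtain ⟨T, hT1, hT2, hT3, hT4⟩ := hreg.exists_forall_not_isJump hcoercive ha hunif hε hεr hεg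
    hstep hland (by rw [hx0]) hΞ0 (by rwa [hx0])
  obtain ⟨p, hp, hlim⟩ := hreg.exists_tendsto_isLocalMin hcoercive ha hunif hε hεr hεg
    (x := fun k => x (T + k)) (Ξ := fun k => Ξ (T + k)) (fun k => hstep (T + k))
    (fun k => hland (T + k)) hT1 hT2 hT3 hT4
  refine ⟨p, hp, (tendsto_add_atTop_iff_nat T).1 ?_⟩
  simpa only [add_comm T] using hlim

end CCRGD

theorem mainTheorem1 (n : ℕ) (f : EuclideanSpace ℝ (Fin n) → ℝ) (L M β : ℝ)
    (hL : 0 < L) (hβ : 0 < β)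
    (hf : ContDiff ℝ 2 f)
    (hcoercive : Tendsto f (Bornology.cobounded (EuclideanSpace ℝ (Fin n))) atTop)
    (hgrad : ∀ x y, ‖gradient f x - gradient f y‖ ≤ L * ‖x - y‖)
    (hhess : ∀ x y, ‖CCRGD.hessian f x - CCRGD.hessian f y‖ ≤ M * ‖x - y‖)
    (hmorse : ∀ x, gradient f x = 0 →
      ∀ lam : ℝ, CCRGD.IsEigenvalue (CCRGD.hessian f x) lam → β < |lam|)
    (x₀ : EuclideanSpace ℝ (Fin n)) (hx₀ : ¬ CCRGD.IsStrictSaddle f x₀) :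
    ∃ ε₀ : ℝ, 0 < ε₀ ∧ ∀ ε : ℝ, 0 < ε → ε < ε₀ → ∀ P : ℝ,
      ∀ x : ℕ → EuclideanSpace ℝ (Fin n), CCRGD.IsIterateSequence f L β ε P x₀ x →
        (∀ k, gradient f (x k) ≠ 0 → ¬ CCRGD.IsStrictSaddle f (CCRGD.gradStep f L (x k))) →
        ∃ xs : EuclideanSpace ℝ (Fin n), IsLocalMin f xs ∧
          (∃ φ : ℕ → ℕ, StrictMono φ ∧ Tendsto (x ∘ φ) atTop (𝓝 xs)) ∧
          CCRGD.IsFixedPointOfAlgorithm f L β ε P xs ∧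
          Tendsto x atTop (𝓝 xs) := by
  obtain ⟨ε₀, hε₀, h⟩ := CCRGD.exists_isLocalMin_tendsto_of_isIterateSequence hL hβ hf hcoercive
    hgrad hhess hmorse hx₀
  refine ⟨ε₀, hε₀, fun ε hε hεlt P x hx hland => ?_⟩
  obtain ⟨xs, hmin, hlim⟩ := h ε hε hεlt P x hx hland
  exact ⟨xs, hmin, ⟨id, strictMono_id, hlim⟩,
    CCRGD.isFixedPointOfAlgorithm_of_gradient_eq_zero β ε P
      (CCRGD.gradient_eq_zero_of_isLocalMin hmin), hlim⟩
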